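/- Let $d\in\mathbb{N}$, $Y=[0,2\pi)^d$, $\mathcal{M}_Y(f)=\frac{1}{|Y|}\int_Y f\,dy$, and let $A=(a_{jk})_{j,k=1}^d$ be a matrix of real, bounded, measurable functions on $\mathbb{R}^d$ that is symmetric, $Y$-periodic ($A(y+2\pi p)=A(y)$ for $p\in\mathbb{Z}^d$) and elliptic: there is $\alpha>0$ with $A(y)\xi\cdot\xi\ge\alpha|\xi|^2$ for all $\xi\in\mathbb{R}^d$ and a.e. $y$. Let $H^2_\sharp(Y)$ be the space of complex-valued $Y$-periodic $H^2$ functions. Fix $\rho>0$ and, for $\eta\in\mathbb{R}^d$ and $u,v\in H^2_\sharp(Y)$, put $$a^\rho[\eta](u,v)=\int_Y A(\nabla+i\eta)u\cdot\overline{(\nabla+i\eta)v}\,dy+\rho^2\int_Y(\nabla+i\eta)^2u\,\overline{(\nabla+i\eta)^2v}\,dy .$$ A real number $\mu$ is a Bloch eigenvalue of $\rho^2\Delta^2-\nabla\cdot A\nabla$ at $\eta$, with eigenfunction $0\ne u\in H^2_\sharp(Y)$, if $a^\rho[\eta](u,v)=\mu\int_Y u\overline v\,dy$ for all $v\in H^2_\sharp(Y)$;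 $\lambda_1^\rho(\eta)$ denotes the smallest Bloch eigenvalue at $\eta$. For $1\le l\le d$ let $\chi_l^\rho\in H^2_\sharp(Y)$ be the weak solution of the cell problem $$\rho^2\Delta^2\chi_l^\rho-\operatorname{div}A(e_l+\nabla\chi_l^\rho)=0,\qquad \mathcal{M}_Y(\chi_l^\rho)=0,$$ and let $A^{\rho,\mathrm{hom}}=\mathcal{M}_Y(A+A\nabla\chi^\rho)$, i.e. $A^{\rho,\mathrm{hom}}_{kl}=\mathcal{M}_Y\big(a_{kl}+\sum_j a_{kj}\,\partial_{y_j}\chi_l^\rho\big)$. Then each $\chi_l^\rho$ exists and is unique, and there is $\delta>0$ such that for $|\eta|<\delta$ the smallest eigenvalue $\lambda_1^\rho(\eta)$ exists and is a real-analytic function of $\eta$, with an eigenfunction $\phi_1^\rho(\cdot;\eta)\in H^2_\sharp(Y)$ normalized by $\mathcal{M}_Y(\phi_1^\rho(\cdot;\eta))=(2\pi)^{-d/2}$ and depending analytically on $\eta$ as an element of $H^2_\sharp(Y)$. Moreover: 1. $\lambda_1^\rho(0)=0$. 2. $\frac{\partial\lambda_1^\rho}{\partial\eta_l}(0)=0$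 for $l=1,\dots,d$. 3. For every such normalized analytic choice of $\phi_1^\rho$ near $\eta=0$ and every $l=1,\dots,d$, the function $y\mapsto\frac{\partial\phi_1^\rho}{\partial\eta_l}(y;0)-i\,\phi_1^\rho(y;0)\,\chi_l^\rho(y)$ is (a.e.) constant. 4. $\frac12\frac{\partial^2\lambda_1^\rho}{\partial\eta_k\partial\eta_l}(0)=e_k\cdot A^{\rho,\mathrm{hom}}e_l$ for all $k,l=1,\dots,d$. -/

import Mathlib

open MeasureTheory
open scoped ComplexConjugate ENNReal

noncomputable section

namespace BlochWave

/-- The basic periodicity cell `Y = [0, 2π)^d`, parametrizing the torus. -/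
def cell (d : ℕ) : Set (Fin d → ℝ) :=
  Set.pi Set.univ fun _ => Set.Ico 0 (2 * Real.pi)

/-- The space `L²_♯(Y)` of complex-valued `Y`-periodic `L²` functions; a periodic function is
given by its restriction to the cell `Y`. -/
abbrev L2 (d : ℕ) : Type :=
  Lp ℂ 2 ((volume : Measure (Fin d → ℝ)).restrict (cell d))

/-- The mean value `M_Y(f) = |Y|⁻¹ ∫_Y f`. -/
def cellMean {d : ℕ} (f : (Fin d → ℝ) → ℂ) : ℂ :=
  ⨍ y in cell d, f y

/-- The Fourier mode `y ↦ exp (i n · y)`. -/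
def fourierMode {d : ℕ} (n : Fin d → ℤ) (y : Fin d → ℝ) : ℂ :=
  Complex.exp (Complex.I * ∑ j, (n j : ℂ) * (y j : ℂ))

/-- The Fourier coefficient `û(n) = |Y|⁻¹ ∫_Y u(y) exp (-i n · y) dy`. -/
def fourierCoeff {d : ℕ} (u : L2 d) (n : Fin d → ℤ) : ℂ :=
  cellMean fun y => u y * conj (fourierMode n y)

/-- `g` is the distributional derivative `∂u/∂y_j` of `u` as a periodic distribution,
i.e. `ĝ(n) = i n_j û(n)` for every `n ∈ ℤ^d`. -/
def IsPartialDeriv {d : ℕ} (j : Fin d) (u g : L2 d) : Prop :=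
  ∀ n : Fin d → ℤ, fourierCoeff g n = Complex.I * (n j : ℂ) * fourierCoeff u n

theorem volume_cell_lt_top (d : ℕ) : (volume : Measure (Fin d → ℝ)) (cell d) < ∞ := by
  rw [cell, Real.volume_pi_Ico]
  exact ENNReal.prod_lt_top fun _ _ => ENNReal.ofReal_lt_top

instance (d : ℕ) : IsFiniteMeasure ((volume : Measure (Fin d → ℝ)).restrict (cell d)) :=
  isFiniteMeasure_restrict.mpr (volume_cell_lt_top d).ne

theorem continuous_fourierMode {d : ℕ} (n : Fin d → ℤ) : Continuous (fourierMode n) := by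
  unfold fourierMode
  fun_prop

theorem norm_fourierMode {d : ℕ} (n : Fin d → ℤ) (y : Fin d → ℝ) : ‖fourierMode n y‖ = 1 := by
  have h : Complex.I * ∑ j, (n j : ℂ) * (y j : ℂ)
      = ((∑ j, (n j : ℝ) * y j : ℝ) : ℂ) * Complex.I := by
    push_cast
    ring
  rw [fourierMode, h, Complex.norm_exp_ofReal_mul_I]

theorem integrable_mul_fourierMode {d : ℕ} (u : L2 d) (n : Fin d → ℤ) :
    Integrable (fun y => u y * conj (fourierMode n y)) (volume.restrict (cell d)) := by
  have hu : Integrable (fun y => u y) (volume.restrict (cell d)) :=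
    (Lp.memLp u).integrable (by norm_num)
  refine hu.mul_bdd (c := 1) ?_ ?_
  · exact (Complex.continuous_conj.comp (continuous_fourierMode n)).aestronglyMeasurable
  · exact Filter.Eventually.of_forall fun y => by simp [norm_fourierMode]

theorem fourierCoeff_add {d : ℕ} (u v : L2 d) (n : Fin d → ℤ) :
    fourierCoeff (u + v) n = fourierCoeff u n + fourierCoeff v n := by
  simp only [fourierCoeff, cellMean, setAverage_eq]
  rw [← smul_add, ← integral_add (integrable_mul_fourierMode u n) (integrable_mul_fourierMode v n)]
  congr 1
  refine integral_congr_ae ?_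
  filter_upwards [Lp.coeFn_add u v] with y hy
  rw [hy, Pi.add_apply, add_mul]

theorem fourierCoeff_smul {d : ℕ} (c : ℂ) (u : L2 d) (n : Fin d → ℤ) :
    fourierCoeff (c • u) n = c * fourierCoeff u n := by
  simp only [fourierCoeff, cellMean, setAverage_eq]
  rw [mul_smul_comm, ← integral_const_mul]
  congr 1
  refine integral_congr_ae ?_
  filter_upwards [Lp.coeFn_smul c u] with y hy
  rw [hy, Pi.smul_apply, smul_eq_mul, mul_assoc]

theorem fourierCoeff_zero {d : ℕ} (n : Fin d → ℤ) : fourierCoeff (0 : L2 d) n = 0 := by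
  simpa using fourierCoeff_smul 0 (0 : L2 d) n

/-- Index set for the derivatives of order at most two: `u`, `∂_j u` and `∂_j ∂_k u`. -/
abbrev JetIndex (d : ℕ) : Type := Unit ⊕ Fin d ⊕ (Fin d × Fin d)

/-- `H²_♯(Y)` as the space of all `(u, ∂_j u, ∂_j ∂_k u)` in `L²_♯(Y)`, with the norm
`(‖u‖² + ∑_j ‖∂_j u‖² + ∑_{j,k} ‖∂_j ∂_k u‖²)^{1/2}`. -/
def sobolevH2 (d : ℕ) : Submodule ℂ (PiLp 2 fun _ : JetIndex d => L2 d) where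
  carrier := {w | (∀ j, IsPartialDeriv j (w (.inl ())) (w (.inr (.inl j)))) ∧
    ∀ j k, IsPartialDeriv k (w (.inr (.inl j))) (w (.inr (.inr (j, k))))}
  add_mem' := by
    rintro w z ⟨hw, hw'⟩ ⟨hz, hz'⟩
    refine ⟨fun j n => ?_, fun j k n => ?_⟩
    · rw [PiLp.add_apply, PiLp.add_apply, fourierCoeff_add, fourierCoeff_add, hw j n, hz j n]
      ring
    · rw [PiLp.add_apply, PiLp.add_apply, fourierCoeff_add, fourierCoeff_add, hw' j k n, hz' j k n]
      ring
  zero_mem' := by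
    refine ⟨fun j n => ?_, fun j k n => ?_⟩ <;>
    · rw [PiLp.zero_apply, PiLp.zero_apply, fourierCoeff_zero, mul_zero]
  smul_mem' := by
    rintro c w ⟨hw, hw'⟩
    refine ⟨fun j n => ?_, fun j k n => ?_⟩
    · rw [PiLp.smul_apply, PiLp.smul_apply, fourierCoeff_smul, fourierCoeff_smul, hw j n]
      ring
    · rw [PiLp.smul_apply, PiLp.smul_apply, fourierCoeff_smul, fourierCoeff_smul, hw' j k n]
      ring

/-- The Hilbert space `H²_♯(Y)`. -/
abbrev H2 (d : ℕ) : Type := sobolevH2 d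

namespace H2

variable {d : ℕ}

/-- The underlying `L²` function of `u ∈ H²_♯(Y)`. -/
def toL2 (u : H2 d) : L2 d := u.1 (.inl ())

/-- `∂u/∂y_j`. -/
def grad (u : H2 d) (j : Fin d) : L2 d := u.1 (.inr (.inl j))

/-- `∂²u/∂y_j∂y_k`. -/
def hess (u : H2 d) (j k : Fin d) : L2 d := u.1 (.inr (.inr (j, k)))

/-- `Δu`. -/
def laplacian (u : H2 d) : L2 d := ∑ j, u.hess j j

/-- The `j`-th component `∂_j u + i η_j u` of `(∇ + iη) u`. -/
def shiftedGrad (η : EuclideanSpace ℝ (Fin d)) (u : H2 d) (j : Fin d) : L2 d :=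
  u.grad j + (Complex.I * (η j : ℂ)) • u.toL2

/-- `(∇ + iη)² u = Δu + 2 i η · ∇u - |η|² u`. -/
def shiftedLaplacian (η : EuclideanSpace ℝ (Fin d)) (u : H2 d) : L2 d :=
  u.laplacian + ∑ j, (2 * Complex.I * (η j : ℂ)) • u.grad j - ((‖η‖ ^ 2 : ℝ) : ℂ) • u.toL2

end H2

/-- A real, bounded, measurable, uniformly elliptic, `Y`-periodic and symmetric coefficient
matrix. -/
structure IsCoefficient {d : ℕ} (A : (Fin d → ℝ) → Matrix (Fin d) (Fin d) ℝ) : Prop where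
  measurable : ∀ j k, AEMeasurable (fun y => A y j k) volume
  bounded : ∃ C : ℝ, ∀ j k, ∀ᵐ y, |A y j k| ≤ C
  elliptic : ∃ α : ℝ, 0 < α ∧ ∀ᵐ y, ∀ ξ : Fin d → ℝ,
    α * ∑ j, ξ j ^ 2 ≤ ∑ j, ∑ k, A y j k * ξ k * ξ j
  periodic : ∀ p : Fin d → ℤ, ∀ᵐ y, A (fun j => y j + 2 * Real.pi * (p j : ℝ)) = A y
  symmetric : ∀ᵐ y, (A y).IsSymm

section Operator

variable {d : ℕ} (A : (Fin d → ℝ) → Matrix (Fin d) (Fin d) ℝ) (ρ : ℝ)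

/-- The form `a^ρ[η](u, v) = ∫_Y A (∇+iη)u · conj((∇+iη)v) + ρ² ∫_Y (∇+iη)²u conj((∇+iη)²v)` on
`H²_♯(Y)`, associated with the shifted operator
`A^ρ(η) = ρ² (∇+iη)⁴ - (∇+iη) · A (∇+iη)`. -/
def blochForm (η : EuclideanSpace ℝ (Fin d)) (u v : H2 d) : ℂ :=
  (∫ y in cell d, ∑ j, ∑ k,
      (A y j k : ℂ) * H2.shiftedGrad η u k y * conj (H2.shiftedGrad η v j y)) +
    (ρ : ℂ) ^ 2 * ∫ y in cell d,
      H2.shiftedLaplacian η u y * conj (H2.shiftedLaplacian η v y)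

/-- `u ∈ H²_♯(Y)` is a (weak) solution of `A^ρ(η) u = μ u`. -/
def SolvesBloch (η : EuclideanSpace ℝ (Fin d)) (μ : ℝ) (u : H2 d) : Prop :=
  ∀ v : H2 d, blochForm A ρ η u v = (μ : ℂ) * ∫ y in cell d, u.toL2 y * conj (v.toL2 y)

/-- The set of Bloch eigenvalues at the dual parameter `η`. -/
def blochEigenvalues (η : EuclideanSpace ℝ (Fin d)) : Set ℝ :=
  {μ | ∃ u : H2 d, u ≠ 0 ∧ SolvesBloch A ρ η μ u}

/-- The first (smallest) Bloch eigenvalue `λ₁^ρ(η)`. -/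
def firstBlochEigenvalue (η : EuclideanSpace ℝ (Fin d)) : ℝ :=
  sInf (blochEigenvalues A ρ η)

/-- `φ` is an analytic choice, for `|η| < δ`, of first Bloch eigenfunctions
`φ₁^ρ(·; η) ∈ H²_♯(Y)`, normalized by `M_Y(φ₁^ρ(·; η)) = (2π)^{-d/2}`. -/
structure IsFirstBlochEigenfunction (δ : ℝ) (φ : EuclideanSpace ℝ (Fin d) → H2 d) : Prop where
  analytic : AnalyticOnNhd ℝ φ (Metric.ball 0 δ)
  solves : ∀ η ∈ Metric.ball (0 : EuclideanSpace ℝ (Fin d)) δ,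
    SolvesBloch A ρ η (firstBlochEigenvalue A ρ η) (φ η)
  normalized : ∀ η ∈ Metric.ball (0 : EuclideanSpace ℝ (Fin d)) δ,
    cellMean (φ η).toL2 = (((2 * Real.pi) ^ (-(d : ℝ) / 2) : ℝ) : ℂ)

/-- `χ ∈ H²_♯(Y)` is a (weak) solution of the cell problem
`ρ² Δ² χ - div A (e_l + ∇χ) = 0`, `M_Y(χ) = 0`. -/
def SolvesCellProblem (l : Fin d) (χ : H2 d) : Prop :=
  cellMean χ.toL2 = 0 ∧ ∀ v : H2 d,
    (ρ : ℂ) ^ 2 * (∫ y in cell d, χ.laplacian y * conj (v.laplacian y)) +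
      (∫ y in cell d, ∑ j, ∑ k,
        (A y j k : ℂ) * ((if k = l then 1 else 0) + χ.grad k y) * conj (v.grad j y)) = 0

/-- The homogenized matrix `M_Y(A + A ∇χ)`, where `(∇χ)_{jl} = ∂χ_l/∂y_j`. -/
def homogenizedMatrix (χ : Fin d → H2 d) : Matrix (Fin d) (Fin d) ℂ := fun k l =>
  cellMean fun y => (A y k l : ℂ) + ∑ j, (A y k j : ℂ) * (χ l).grad j y

end Operator

/-- The partial derivative `∂f/∂η_l`. -/
def partialEta {d : ℕ} {E : Type*} [NormedAddCommGroup E] [NormedSpace ℝ E] (l : Fin d)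
    (f : EuclideanSpace ℝ (Fin d) → E) (η : EuclideanSpace ℝ (Fin d)) : E :=
  fderiv ℝ f η (EuclideanSpace.single l 1)

end BlochWave

end

open BlochWave

/-
The form `a^ρ[η]` is represented on `H²_♯(Y)` by a bounded self-adjoint operator that is polynomial
in `η`, and the `L²` pairing by an injective one.  At `η = 0` the form kills exactly the constants
and is coercive on mean-zero functions, so the implicit function theorem, applied to the eigenvalue
equation with the mean of the eigenfunction prescribed, yields an analytic eigenpair near `η = 0`.
Parseval's identity bounds the Rayleigh quotient from below on mean-zero functions for
`|η_j| ≤ 1/2`, uniformly in `η`; as the analytic eigenvalue tends to `0`, an eigenfunction for a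
smaller eigenvalue would combine with the analytic one to a mean-zero function violating this bound.

Since `λ ≥ 0 = λ(0)`, the gradient of `λ` vanishes at `0`.  Differentiating the eigenvalue equation
at `0` then shows that `∂_l φ(0)` solves the cell problem up to the factor `i φ(0)`.  Testing the
eigenvalue equation with the constant `1` expresses `λ(η)` as `∑ η_k` times the mean flux of the
eigenfunction, and the first derivative of that flux at `0` is the homogenized matrix.
-/

noncomputable section

namespace BlochWave

open Filter
open scoped ContDiff InnerProductSpace Topology

section ScalarRestriction

theorem contDiffAt_clm_comp {𝕜 E F K G : Type*} [RCLike 𝕜] [NormedAddCommGroup E] [NormedSpace 𝕜 E]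
    [NormedAddCommGroup F] [NormedSpace 𝕜 F] [NormedSpace ℝ F] [IsScalarTower ℝ 𝕜 F]
    [NormedAddCommGroup K] [NormedSpace 𝕜 K] [NormedSpace ℝ K] [IsScalarTower ℝ 𝕜 K]
    [NormedAddCommGroup G] [NormedSpace ℝ G] {n : WithTop ℕ∞} {T : G → F →L[𝕜] K}
    {D : G → E →L[𝕜] F} {x : G} (hT : ContDiffAt ℝ n T x) (hD : ContDiffAt ℝ n D x) :
    ContDiffAt ℝ n (fun y => T y ∘L D y) x := by
  have hcomp : ContDiff ℝ n fun S : F →L[𝕜] K =>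
      (ContinuousLinearMap.compL 𝕜 E F K).bilinearRestrictScalars ℝ S :=
    ContinuousLinearMap.contDiff _
  exact (hcomp.contDiffAt.comp x hT).clm_apply hD

variable {𝕜 E F G : Type*} [RCLike 𝕜] [NormedAddCommGroup E] [NormedSpace 𝕜 E] [NormedSpace ℝ E]
  [IsScalarTower ℝ 𝕜 E] [NormedAddCommGroup F] [NormedSpace 𝕜 F] [NormedSpace ℝ F]
  [IsScalarTower ℝ 𝕜 F] [NormedAddCommGroup G] [NormedSpace ℝ G]

theorem contDiffAt_clm_apply {n : WithTop ℕ∞} {T : G → E →L[𝕜] F} {u : G → E} {x : G}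
    (hT : ContDiffAt ℝ n T x) (hu : ContDiffAt ℝ n u x) :
    ContDiffAt ℝ n (fun y => T y (u y)) x :=
  ((ContinuousLinearMap.restrictScalarsL 𝕜 E F ℝ ℝ).contDiff.contDiffAt.comp x hT).clm_apply hu

theorem hasFDerivAt_clm_apply {T : G → E →L[𝕜] F} {u : G → E} {x : G}
    {T' : G →L[ℝ] E →L[𝕜] F} {u' : G →L[ℝ] E}
    (hT : HasFDerivAt T T' x) (hu : HasFDerivAt u u' x) :
    HasFDerivAt (fun y => T y (u y)) (((T x).restrictScalars ℝ) ∘L u' +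
      ((ContinuousLinearMap.restrictScalarsL 𝕜 E F ℝ ℝ) ∘L T').flip (u x)) x :=
  ((ContinuousLinearMap.restrictScalarsL 𝕜 E F ℝ ℝ).hasFDerivAt.comp x hT).clm_apply hu

end ScalarRestriction

section AnalyticEigenpair

variable {𝕜 E G : Type*} [RCLike 𝕜] [NormedAddCommGroup E] [NormedSpace 𝕜 E]

/-- `(η, u) ↦ L(η) u - (1 - ℓ(u)) M u`, the eigenvalue equation with the eigenvalue eliminated: a
zero `u` is an eigenvector of the pencil `(L(η), M)` for the eigenvalue `1 - ℓ(u)`. -/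
def eigenResidual (L : G → E →L[𝕜] E) (M : E →L[𝕜] E) (ℓ : E →L[𝕜] 𝕜) (x : G × E) : E :=
  L x.1 x.2 - (1 - ℓ x.2) • M x.2

variable {L : G → E →L[𝕜] E} {M : E →L[𝕜] E} {ℓ : E →L[𝕜] 𝕜} {η₀ : G} {e : E}

theorem hasFDerivAt_eigenResidual_right (he : ℓ e = 1) :
    HasFDerivAt (fun u => eigenResidual L M ℓ (η₀, u))
      (L η₀ + ℓ.smulRight (M e)) e := by
  have hℓ : HasFDerivAt (fun u => 1 - ℓ u) (-ℓ) e := ℓ.hasFDerivAt.const_sub 1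
  refine ((L η₀).hasFDerivAt.sub (hℓ.fun_smul M.hasFDerivAt)).congr_fderiv ?_
  ext u
  simp [he]

variable [NormedSpace ℝ E] [IsScalarTower ℝ 𝕜 E] [NormedAddCommGroup G] [NormedSpace ℝ G]

theorem contDiffAt_eigenResidual {n : WithTop ℕ∞} (hL : ContDiffAt ℝ n L η₀) :
    ContDiffAt ℝ n (eigenResidual L M ℓ) (η₀, e) := by
  have hℓ : ContDiff ℝ n fun x : G × E => ℓ x.2 :=
    (ℓ.restrictScalars ℝ).contDiff.comp contDiff_snd
  have hM : ContDiff ℝ n fun x : G × E => M x.2 :=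
    (M.restrictScalars ℝ).contDiff.comp contDiff_snd
  exact (contDiffAt_clm_apply (ContDiffAt.comp (η₀, e) hL contDiffAt_fst) contDiffAt_snd).sub
    ((contDiff_const.sub hℓ).fun_smul hM).contDiffAt

variable [CompleteSpace E] [CompleteSpace G]

theorem exists_analyticAt_eigenResidual_eq_zero (hL : ContDiffAt ℝ ω L η₀) (he : ℓ e = 1)
    (h0 : L η₀ e = 0) (hunit : IsUnit (L η₀ + ℓ.smulRight (M e))) :
    ∃ u : G → E, AnalyticAt ℝ u η₀ ∧ u η₀ = e ∧ ∀ᶠ η in 𝓝 η₀, eigenResidual L M ℓ (η, u η) = 0 := by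
  have hR : ContDiffAt ℝ ω (eigenResidual L M ℓ) (η₀, e) := contDiffAt_eigenResidual hL
  have hderiv : fderiv ℝ (eigenResidual L M ℓ) (η₀, e) ∘L .inr ℝ G E =
      (L η₀ + ℓ.smulRight (M e)).restrictScalars ℝ :=
    ((hR.differentiableAt (by simp)).hasFDerivAt.comp e (hasFDerivAt_prodMk_right η₀ e)).unique
      ((hasFDerivAt_eigenResidual_right he).restrictScalars ℝ)
  have hinv : (fderiv ℝ (eigenResidual L M ℓ) (η₀, e) ∘L .inr ℝ G E).IsInvertible := by
    obtain ⟨T, hT⟩ := hunit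
    exact ⟨(ContinuousLinearEquiv.ofUnit T).restrictScalars ℝ, by rw [hderiv, ← hT]; rfl⟩
  refine ⟨hR.implicitFunction (by simp) hinv,
    (hR.contDiffAt_implicitFunction (by simp) hinv).analyticAt,
    hR.implicitFunction_apply_self (by simp) hinv, ?_⟩
  filter_upwards [hR.eventually_apply_implicitFunction (by simp) hinv] with η hη
  rw [hη]
  simp [eigenResidual, h0, he]

theorem exists_analyticAt_eigenpair (hL : ContDiffAt ℝ ω L η₀) (he : ℓ e = 1)
    (h0 : L η₀ e = 0) (hunit : IsUnit (L η₀ + ℓ.smulRight (M e))) :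
    ∃ (μ : G → 𝕜) (φ : G → E), AnalyticAt ℝ μ η₀ ∧ AnalyticAt ℝ φ η₀ ∧ μ η₀ = 0 ∧ φ η₀ = e ∧
      ∀ᶠ η in 𝓝 η₀, ℓ (φ η) = 1 ∧ L η (φ η) = μ η • M (φ η) := by
  obtain ⟨u, hu, hu0, hzero⟩ := exists_analyticAt_eigenResidual_eq_zero hL he h0 hunit
  have hℓu : AnalyticAt ℝ (fun η => ℓ (u η)) η₀ :=
    ((ℓ.restrictScalars ℝ).analyticAt _).comp hu
  have hne : ℓ (u η₀) ≠ 0 := by rw [hu0, he]; exact one_ne_zero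
  refine ⟨fun η => 1 - ℓ (u η), fun η => (ℓ (u η))⁻¹ • u η, analyticAt_const.sub hℓu,
    (hℓu.inv hne).smul hu, by simp [hu0, he], by simp [hu0, he], ?_⟩
  filter_upwards [hzero, hℓu.continuousAt.eventually_ne hne] with η hη hηne
  rw [map_smul, map_smul, map_smul, smul_eq_mul, inv_mul_cancel₀ hηne,
    sub_eq_zero.1 hη, smul_comm]
  exact ⟨rfl, rfl⟩

end AnalyticEigenpair

section SymmetricPencil

variable {𝕜 E : Type*} [RCLike 𝕜] [NormedAddCommGroup E] [InnerProductSpace 𝕜 E]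
  {T M : E →ₗ[𝕜] E} {φ u : E}

theorem conj_mul_inner_eq_of_pencil_eigenvectors (hT : T.IsSymmetric) (hM : M.IsSymmetric)
    {z w : 𝕜} (hφ : T φ = z • M φ) (hu : T u = w • M u) :
    conj z * ⟪φ, M u⟫_𝕜 = w * ⟪φ, M u⟫_𝕜 :=
  calc conj z * ⟪φ, M u⟫_𝕜 = ⟪T φ, u⟫_𝕜 := by rw [hφ, inner_smul_left, hM]
    _ = w * ⟪φ, M u⟫_𝕜 := by rw [hT, hu, inner_smul_right]

theorem conj_eq_of_pencil_eigenvector (hT : T.IsSymmetric) (hM : M.IsSymmetric)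
    {z : 𝕜} (hφ : T φ = z • M φ) (hne : ⟪φ, M φ⟫_𝕜 ≠ 0) : conj z = z :=
  mul_right_cancel₀ hne (conj_mul_inner_eq_of_pencil_eigenvectors hT hM hφ hφ)

theorem inner_eq_zero_of_pencil_eigenvectors (hT : T.IsSymmetric) (hM : M.IsSymmetric)
    {lam μ : ℝ} (hφ : T φ = (lam : 𝕜) • M φ) (hu : T u = (μ : 𝕜) • M u) (hne : lam ≠ μ) :
    ⟪φ, M u⟫_𝕜 = 0 := by
  have h := conj_mul_inner_eq_of_pencil_eigenvectors hT hM hφ hu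
  rw [RCLike.conj_ofReal] at h
  by_contra h0
  exact hne (RCLike.ofReal_injective (mul_right_cancel₀ h0 h))

theorem re_inner_pencil_combination (hT : T.IsSymmetric) (hM : M.IsSymmetric)
    {lam μ : ℝ} (hφ : T φ = (lam : 𝕜) • M φ) (hu : T u = (μ : 𝕜) • M u) (hne : lam ≠ μ) (a b : 𝕜) :
    RCLike.re ⟪a • u - b • φ, T (a • u - b • φ)⟫_𝕜 =
      lam * RCLike.re ⟪a • u - b • φ, M (a • u - b • φ)⟫_𝕜 +
        (μ - lam) * (‖a‖ ^ 2 * RCLike.re ⟪u, M u⟫_𝕜) := by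
  set z := a • u - b • φ with hz
  have hTz : T z = (lam : 𝕜) • M z + (((μ - lam : ℝ) : 𝕜) * a) • M u := by
    simp only [hz, map_sub, map_smul, hφ, hu]
    module
  have hzu : ⟪z, M u⟫_𝕜 = conj a * ⟪u, M u⟫_𝕜 := by
    rw [hz, inner_sub_left, inner_smul_left, inner_smul_left,
      inner_eq_zero_of_pencil_eigenvectors hT hM hφ hu hne, mul_zero, sub_zero]
  have hinner : ⟪z, T z⟫_𝕜 =
      (lam : 𝕜) * ⟪z, M z⟫_𝕜 + (((μ - lam) * ‖a‖ ^ 2 : ℝ) : 𝕜) * ⟪u, M u⟫_𝕜 := by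
    rw [hTz, inner_add_right, inner_smul_right, inner_smul_right, hzu, mul_assoc,
      ← mul_assoc a, RCLike.mul_conj]
    push_cast
    ring
  rw [hinner, map_add, RCLike.re_ofReal_mul, RCLike.re_ofReal_mul, mul_assoc]

/- A combination of `φ` and `u` in the kernel of `ℓ` has Rayleigh quotient at least `κ ≥ lam`, but
this quotient is an average of `lam` and `μ`, so `μ < lam` is impossible. -/
theorem le_of_pencil_eigenvectors (hT : T.IsSymmetric) (hM : M.IsPositive) {ℓ : E →ₗ[𝕜] 𝕜}
    {κ lam μ : ℝ} (hκ : ∀ v, ℓ v = 0 → κ * RCLike.re ⟪v, M v⟫_𝕜 ≤ RCLike.re ⟪v, T v⟫_𝕜)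
    (hlam : lam ≤ κ) (hφ : T φ = (lam : 𝕜) • M φ) (hℓφ : ℓ φ ≠ 0)
    (hu : T u = (μ : 𝕜) • M u) (hpos : 0 < RCLike.re ⟪u, M u⟫_𝕜) : lam ≤ μ := by
  by_contra! hlt
  set z := ℓ φ • u - ℓ u • φ with hz
  have hℓz : ℓ z = 0 := by
    rw [hz, map_sub, map_smul, map_smul, smul_eq_mul, smul_eq_mul, mul_comm, sub_self]
  have hform := re_inner_pencil_combination hT hM.isSymmetric hφ hu hlt.ne' (ℓ φ) (ℓ u)
  have hgap : 0 ≤ (κ - lam) * RCLike.re ⟪z, M z⟫_𝕜 :=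
    mul_nonneg (sub_nonneg.2 hlam) (hM.re_inner_nonneg_right z)
  have hdrop : 0 < (lam - μ) * (‖ℓ φ‖ ^ 2 * RCLike.re ⟪u, M u⟫_𝕜) := by
    have := norm_pos_iff.2 hℓφ
    have := sub_pos.2 hlt
    positivity
  linarith [hκ z hℓz]

end SymmetricPencil

section CoerciveModuloLine

variable {𝕜 E : Type*} [RCLike 𝕜] [NormedAddCommGroup E] [InnerProductSpace 𝕜 E]
  {T : E →L[𝕜] E} {ℓ : E →L[𝕜] 𝕜} {e m f u : E} {κ V : ℝ}

theorem eq_zero_of_coercive_on_ker (hκ : 0 < κ)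
    (hcoer : ∀ v, ℓ v = 0 → κ * ‖v‖ ^ 2 ≤ RCLike.re ⟪v, T v⟫_𝕜) (hu : ℓ u = 0) (hTu : T u = 0) :
    u = 0 := by
  have h := hcoer u hu
  rw [hTu, inner_zero_right, map_zero] at h
  have hsq : ‖u‖ ^ 2 = 0 := by nlinarith [sq_nonneg ‖u‖]
  exact norm_eq_zero.1 (sq_eq_zero_iff.1 hsq)

theorem eq_smul_of_coercive_on_ker (he : ℓ e = 1) (hTe : T e = 0) (hκ : 0 < κ)
    (hcoer : ∀ v, ℓ v = 0 → κ * ‖v‖ ^ 2 ≤ RCLike.re ⟪v, T v⟫_𝕜) (hTu : T u = 0) :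
    u = ℓ u • e :=
  sub_eq_zero.1 <| eq_zero_of_coercive_on_ker hκ hcoer (by simp [he]) (by simp [hTu, hTe])

theorem inner_map_eq_zero_of_map_eq_zero (hT : (T : E →ₗ[𝕜] E).IsSymmetric) (hTe : T e = 0)
    (v : E) : ⟪T v, e⟫_𝕜 = 0 := by
  rw [hT.apply_clm, hTe, inner_zero_right]

theorem re_inner_add_smulRight_ge (hT : (T : E →ₗ[𝕜] E).IsSymmetric) (he : ℓ e = 1)
    (hTe : T e = 0) (hcoer : ∀ v, ℓ v = 0 → κ * ‖v‖ ^ 2 ≤ RCLike.re ⟪v, T v⟫_𝕜)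
    (hm : ∀ v, ⟪m, v⟫_𝕜 = V * ℓ v) (v : E) :
    κ * ‖v - ℓ v • e‖ ^ 2 + V * ‖ℓ v‖ ^ 2 ≤ RCLike.re ⟪(T + ℓ.smulRight m) v, v⟫_𝕜 := by
  have hTv : T (v - ℓ v • e) = T v := by rw [map_sub, map_smul, hTe, smul_zero, sub_zero]
  have hTinner : ⟪v - ℓ v • e, T (v - ℓ v • e)⟫_𝕜 = ⟪T v, v⟫_𝕜 := by
    rw [← hT.apply_clm, hTv, inner_sub_right, inner_smul_right,
      inner_map_eq_zero_of_map_eq_zero hT hTe, mul_zero, sub_zero]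
  have hminner : ⟪ℓ v • m, v⟫_𝕜 = ((V * ‖ℓ v‖ ^ 2 : ℝ) : 𝕜) := by
    rw [inner_smul_left, hm, mul_left_comm, RCLike.conj_mul]
    push_cast
    rfl
  rw [add_apply, inner_add_left, ContinuousLinearMap.smulRight_apply, hminner, map_add,
    RCLike.ofReal_re, ← hTinner]
  gcongr
  exact hcoer _ (by simp [he])

theorem isUnit_add_smulRight [CompleteSpace E] (hT : (T : E →ₗ[𝕜] E).IsSymmetric) (he : ℓ e = 1)
    (hTe : T e = 0) (hκ : 0 < κ) (hcoer : ∀ v, ℓ v = 0 → κ * ‖v‖ ^ 2 ≤ RCLike.re ⟪v, T v⟫_𝕜)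
    (hV : 0 < V) (hm : ∀ v, ⟪m, v⟫_𝕜 = V * ℓ v) : IsUnit (T + ℓ.smulRight m) := by
  have hV' : 0 < V / (‖e‖ ^ 2 + 1) := by positivity
  set c : ℝ := min κ (V / (‖e‖ ^ 2 + 1))
  have hc0 : 0 < c := lt_min hκ hV'
  refine ContinuousLinearMap.isUnit_of_forall_le_norm_inner_map _ (c := ⟨c / 2, by positivity⟩)
    (half_pos hc0) fun v => ?_
  have hsplit : ‖v‖ ^ 2 ≤ 2 * (‖v - ℓ v • e‖ ^ 2 + (‖e‖ ^ 2 + 1) * ‖ℓ v‖ ^ 2) := by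
    have h : ‖v‖ ≤ ‖v - ℓ v • e‖ + ‖ℓ v‖ * ‖e‖ := by
      simpa [norm_smul] using norm_add_le (v - ℓ v • e) (ℓ v • e)
    nlinarith [sq_nonneg (‖v - ℓ v • e‖ - ‖ℓ v‖ * ‖e‖), sq_nonneg ‖ℓ v‖, norm_nonneg v]
  calc ‖v‖ ^ 2 * (c / 2) ≤ c * ‖v - ℓ v • e‖ ^ 2 + c * (‖e‖ ^ 2 + 1) * ‖ℓ v‖ ^ 2 := by
        nlinarith
    _ ≤ κ * ‖v - ℓ v • e‖ ^ 2 + V * ‖ℓ v‖ ^ 2 := by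
        have h1 : c ≤ κ := min_le_left _ _
        have h2 : c * (‖e‖ ^ 2 + 1) ≤ V := (le_div_iff₀ (by positivity)).1 (min_le_right _ _)
        gcongr
    _ ≤ RCLike.re ⟪(T + ℓ.smulRight m) v, v⟫_𝕜 := re_inner_add_smulRight_ge hT he hTe hcoer hm v
    _ ≤ ‖⟪(T + ℓ.smulRight m) v, v⟫_𝕜‖ := RCLike.re_le_norm _

/- Solve `T u + ℓ(u) m = f` and test with `e`: since `T e = 0`, this forces `ℓ(u) = 0`. -/
theorem existsUnique_map_eq_of_coercive_on_ker [CompleteSpace E]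
    (hT : (T : E →ₗ[𝕜] E).IsSymmetric) (he : ℓ e = 1) (hTe : T e = 0) (hκ : 0 < κ)
    (hcoer : ∀ v, ℓ v = 0 → κ * ‖v‖ ^ 2 ≤ RCLike.re ⟪v, T v⟫_𝕜) (hV : 0 < V)
    (hm : ∀ v, ⟪m, v⟫_𝕜 = V * ℓ v) (hf : ⟪f, e⟫_𝕜 = 0) : ∃! u, ℓ u = 0 ∧ T u = f := by
  obtain ⟨S, hS⟩ := isUnit_add_smulRight hT he hTe hκ hcoer hV hm
  obtain ⟨u, hu⟩ := (ContinuousLinearEquiv.ofUnit S).surjective f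
  replace hu : T u + ℓ u • m = f := by
    rw [← hu, ← ContinuousLinearMap.smulRight_apply, ← add_apply, ← hS]; rfl
  have hℓu : ℓ u = 0 := by
    have h := hf
    rw [← hu, inner_add_left, inner_map_eq_zero_of_map_eq_zero hT hTe, inner_smul_left, hm, he] at h
    simpa [hV.ne'] using h
  refine ⟨u, ⟨hℓu, by simpa [hℓu] using hu⟩, fun v ⟨hℓv, hTv⟩ => sub_eq_zero.1 ?_⟩
  refine eq_zero_of_coercive_on_ker hκ hcoer (by rw [map_sub, hℓv, hℓu, sub_zero]) ?_
  rw [map_sub, hTv, ← hu, hℓu, zero_smul, add_zero, sub_self]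

end CoerciveModuloLine

section PartialDerivatives

variable {d : ℕ} {E F : Type*} [NormedAddCommGroup E] [NormedSpace ℝ E] [NormedAddCommGroup F]
  [NormedSpace ℝ F] {η : EuclideanSpace ℝ (Fin d)}

theorem partialEta_eq_of_hasFDerivAt {f : EuclideanSpace ℝ (Fin d) → E}
    {f' : EuclideanSpace ℝ (Fin d) →L[ℝ] E} (h : HasFDerivAt f f' η) (l : Fin d) :
    partialEta l f η = f' (EuclideanSpace.single l 1) := by
  rw [partialEta, h.fderiv]

theorem partialEta_congr {f g : EuclideanSpace ℝ (Fin d) → E} (h : f =ᶠ[𝓝 η] g) (l : Fin d) :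
    partialEta l f η = partialEta l g η := by
  rw [partialEta, partialEta, h.fderiv_eq]

theorem partialEta_add {f g : EuclideanSpace ℝ (Fin d) → E} (hf : DifferentiableAt ℝ f η)
    (hg : DifferentiableAt ℝ g η) (l : Fin d) :
    partialEta l (fun x => f x + g x) η = partialEta l f η + partialEta l g η :=
  partialEta_eq_of_hasFDerivAt (hf.hasFDerivAt.add hg.hasFDerivAt) l

theorem partialEta_clm_comp (S : E →L[ℝ] F) {f : EuclideanSpace ℝ (Fin d) → E}
    (hf : DifferentiableAt ℝ f η) (l : Fin d) :
    partialEta l (fun x => S (f x)) η = S (partialEta l f η) :=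
  partialEta_eq_of_hasFDerivAt (S.hasFDerivAt.comp η hf.hasFDerivAt) l

theorem partialEta_smul {f : EuclideanSpace ℝ (Fin d) → ℝ} {g : EuclideanSpace ℝ (Fin d) → E}
    (hf : DifferentiableAt ℝ f η) (hg : DifferentiableAt ℝ g η) (l : Fin d) :
    partialEta l (fun x => f x • g x) η = f η • partialEta l g η + partialEta l f η • g η :=
  partialEta_eq_of_hasFDerivAt (hf.hasFDerivAt.fun_smul hg.hasFDerivAt) l

theorem contDiffAt_partialEta {n : WithTop ℕ∞} {f : EuclideanSpace ℝ (Fin d) → E}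
    (hf : ContDiffAt ℝ (n + 1) f η) (l : Fin d) : ContDiffAt ℝ n (partialEta l f) η :=
  (hf.fderiv_right le_rfl).clm_apply contDiffAt_const

theorem partialEta_sum_smul {g : Fin d → EuclideanSpace ℝ (Fin d) → E}
    (hg : ∀ j, DifferentiableAt ℝ (g j) η) (l : Fin d) :
    partialEta l (fun x => ∑ j, x j • g j x) η = g l η + ∑ j, η j • partialEta l (g j) η := by
  have h := HasFDerivAt.fun_sum (u := Finset.univ) fun j _ =>
    (EuclideanSpace.proj (𝕜 := ℝ) j).hasFDerivAt.fun_smul (hg j).hasFDerivAt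
  refine (partialEta_eq_of_hasFDerivAt h l).trans ?_
  simp [Finset.sum_add_distrib, partialEta, add_comm]

theorem partialEta_sum_smul_zero {g : Fin d → EuclideanSpace ℝ (Fin d) → E}
    (hg : ∀ j, DifferentiableAt ℝ (g j) 0) (l : Fin d) :
    partialEta l (fun x => ∑ j, x j • g j x) 0 = g l 0 := by
  simp [partialEta_sum_smul hg]

theorem partialEta_partialEta_sum_smul_zero {g : Fin d → EuclideanSpace ℝ (Fin d) → E}
    (hg : ∀ j, ContDiffAt ℝ 2 (g j) 0) (k l : Fin d) :
    partialEta k (partialEta l fun x => ∑ j, x j • g j x) 0 =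
      partialEta k (g l) 0 + partialEta l (g k) 0 := by
  have hdiff : ∀ᶠ x in 𝓝 (0 : EuclideanSpace ℝ (Fin d)), ∀ j, DifferentiableAt ℝ (g j) x :=
    eventually_all.2 fun j => ((hg j).eventually (by simp)).mono fun _ hx =>
      hx.differentiableAt two_ne_zero
  have hpartial : ∀ j, DifferentiableAt ℝ (partialEta l (g j)) 0 := fun j =>
    (contDiffAt_partialEta (n := 1) (hg j) l).differentiableAt one_ne_zero
  have hfirst : partialEta l (fun x => ∑ j, x j • g j x) =ᶠ[𝓝 0]
      fun x => g l x + ∑ j, x j • partialEta l (g j) x :=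
    hdiff.mono fun _ hx => partialEta_sum_smul hx l
  have hsum : DifferentiableAt ℝ
      (fun x : EuclideanSpace ℝ (Fin d) => ∑ j, x j • partialEta l (g j) x) 0 :=
    DifferentiableAt.fun_sum fun j _ =>
      (EuclideanSpace.proj (𝕜 := ℝ) j).differentiableAt.fun_smul (hpartial j)
  rw [partialEta_congr hfirst, partialEta_add (hdiff.self_of_nhds l) hsum,
    partialEta_sum_smul_zero hpartial]

theorem partialEta_const_add_sum_smul_zero (c : E) {g : Fin d → EuclideanSpace ℝ (Fin d) → E}
    (hg : ∀ j, DifferentiableAt ℝ (g j) 0) (l : Fin d) :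
    partialEta l (fun x => c + ∑ j, x j • g j x) 0 = g l 0 := by
  rw [← partialEta_sum_smul_zero hg l, partialEta, partialEta, fderiv_const_add]

theorem contDiff_const_add_sum_smul {n : WithTop ℕ∞} (c : E)
    {g : Fin d → EuclideanSpace ℝ (Fin d) → E} (hg : ∀ j, ContDiff ℝ n (g j)) :
    ContDiff ℝ n fun x : EuclideanSpace ℝ (Fin d) => c + ∑ j, x j • g j x :=
  contDiff_const.add <| ContDiff.sum fun j _ =>
    (EuclideanSpace.proj (𝕜 := ℝ) j).contDiff.smul (hg j)

theorem contDiff_const_sub_smul {n : WithTop ℕ∞} (c c' : E) (j : Fin d) :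
    ContDiff ℝ n fun x : EuclideanSpace ℝ (Fin d) => c - x j • c' :=
  contDiff_const.sub ((EuclideanSpace.proj (𝕜 := ℝ) j).contDiff.smul contDiff_const)

theorem partialEta_clm_apply {𝕜 E F : Type*} [RCLike 𝕜] [NormedAddCommGroup E] [NormedSpace 𝕜 E]
    [NormedSpace ℝ E] [IsScalarTower ℝ 𝕜 E] [NormedAddCommGroup F] [NormedSpace 𝕜 F]
    [NormedSpace ℝ F] [IsScalarTower ℝ 𝕜 F] {T : EuclideanSpace ℝ (Fin d) → E →L[𝕜] F}
    {u : EuclideanSpace ℝ (Fin d) → E}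
    (hT : DifferentiableAt ℝ T η) (hu : DifferentiableAt ℝ u η) (l : Fin d) :
    partialEta l (fun x => T x (u x)) η = T η (partialEta l u η) + partialEta l T η (u η) :=
  partialEta_eq_of_hasFDerivAt (hasFDerivAt_clm_apply hT.hasFDerivAt hu.hasFDerivAt) l

end PartialDerivatives

variable {d : ℕ}

theorem volume_cell (d : ℕ) :
    (volume : Measure (Fin d → ℝ)) (cell d) = ENNReal.ofReal (2 * Real.pi) ^ d := by
  simp [cell, Real.volume_pi_Ico]

theorem volume_cell_ne_zero (d : ℕ) : (volume : Measure (Fin d → ℝ)) (cell d) ≠ 0 := by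
  rw [volume_cell]
  exact pow_ne_zero d (ENNReal.ofReal_pos.2 Real.two_pi_pos).ne'

theorem volume_real_cell_pos (d : ℕ) : 0 < volume.real (cell d) :=
  ENNReal.toReal_pos (volume_cell_ne_zero d) (volume_cell_lt_top d).ne

section Parseval

local instance : MeasureSpace UnitAddCircle := ⟨AddCircle.haarAddCircle⟩
local instance : Measure.IsAddHaarMeasure (volume : Measure UnitAddCircle) :=
  inferInstanceAs (Measure.IsAddHaarMeasure AddCircle.haarAddCircle)
local instance : IsProbabilityMeasure (volume : Measure UnitAddCircle) :=
  inferInstanceAs (IsProbabilityMeasure AddCircle.haarAddCircle)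

/-- The section of the covering map `y ↦ y / 2π` from `ℝ^d` to the torus `(ℝ / ℤ)^d` with values in
`(0, 2π]^d`, along which functions on the cell become functions on the torus. -/
def torusSection (d : ℕ) (t : UnitAddTorus (Fin d)) : Fin d → ℝ :=
  (2 * Real.pi) • (UnitAddTorus.measurableEquivPiIoc (0 : Fin d → ℝ) t).1

theorem fourier_eq_exp_torusSection (m : ℤ) (t : UnitAddTorus (Fin d)) (j : Fin d) :
    fourier m (t j) = Complex.exp (Complex.I * ((m : ℂ) * (torusSection d t j : ℂ))) := by
  have hcoe : ((UnitAddTorus.measurableEquivPiIoc (0 : Fin d → ℝ) t).1 j : UnitAddCircle) = t j :=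
    AddCircle.coe_equivIoc
  rw [← hcoe, fourier_coe_apply]
  simp only [torusSection, Pi.smul_apply, smul_eq_mul]
  push_cast
  ring_nf

theorem mFourier_eq_fourierMode (n : Fin d → ℤ) (t : UnitAddTorus (Fin d)) :
    UnitAddTorus.mFourier n t = fourierMode n (torusSection d t) := by
  rw [fourierMode, Finset.mul_sum, Complex.exp_sum]
  change ∏ j, fourier (n j) (t j) = _
  exact Finset.prod_congr rfl fun j _ => fourier_eq_exp_torusSection (n j) t j

theorem preimage_smul_pi_Ioc {r : ℝ} (hr : 0 < r) :
    (fun x : Fin d → ℝ => r • x) ⁻¹' (Set.univ.pi fun _ => Set.Ioc 0 r) =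
      Set.univ.pi fun _ => Set.Ioc 0 1 := by
  ext x
  simp only [Set.mem_preimage, Set.mem_univ_pi, Pi.smul_apply, smul_eq_mul, Set.mem_Ioc]
  exact forall_congr' fun j =>
    and_congr (mul_pos_iff_of_pos_left hr) (mul_le_iff_le_one_right hr)

theorem restrict_pi_Ioc_eq_restrict_cell (d : ℕ) :
    (volume : Measure (Fin d → ℝ)).restrict (Set.univ.pi fun _ => Set.Ioc 0 (2 * Real.pi)) =
      volume.restrict (cell d) :=
  Measure.restrict_congr_set <|
    (Measure.univ_pi_Ioc_ae_eq_Icc (μ := fun _ => volume)).trans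
      (Measure.univ_pi_Ico_ae_eq_Icc (μ := fun _ => volume)).symm

theorem measurePreserving_smul_unitBox (d : ℕ) :
    MeasurePreserving (fun x : Fin d → ℝ => (2 * Real.pi) • x)
      (volume.restrict (Set.univ.pi fun _ => Set.Ioc 0 1))
      ((volume (cell d))⁻¹ • volume.restrict (cell d)) := by
  have hscale : MeasurePreserving (fun x : Fin d → ℝ => (2 * Real.pi) • x) volume
      ((volume (cell d))⁻¹ • volume) := by
    refine ⟨measurable_const_smul _, ?_⟩
    rw [Measure.map_addHaar_smul _ Real.two_pi_pos.ne', volume_cell, Module.finrank_fin_fun,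
      abs_of_pos (by positivity), ENNReal.ofReal_inv_of_pos (by positivity),
      ENNReal.ofReal_pow Real.two_pi_pos.le]
  have h := hscale.restrict_preimage
    (MeasurableSet.univ_pi fun _ : Fin d => measurableSet_Ioc (a := 0) (b := 2 * Real.pi))
  rwa [preimage_smul_pi_Ioc Real.two_pi_pos, Measure.restrict_smul,
    restrict_pi_Ioc_eq_restrict_cell] at h

theorem measurePreserving_torusSection (d : ℕ) :
    MeasurePreserving (torusSection d) volume
      ((volume (cell d))⁻¹ • volume.restrict (cell d)) := by
  have hbox : {x : Fin d → ℝ | ∀ j, x j ∈ Set.Ioc ((0 : Fin d → ℝ) j) ((0 : Fin d → ℝ) j + 1)} =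
      Set.univ.pi fun _ => Set.Ioc 0 1 := by
    ext x
    simp
  have hval := measurePreserving_subtype_coe (μa := (volume : Measure (Fin d → ℝ)))
    (hbox ▸ MeasurableSet.univ_pi fun _ => measurableSet_Ioc)
  have hscale := measurePreserving_smul_unitBox d
  rw [← hbox] at hscale
  exact hscale.comp (hval.comp (UnitAddTorus.measurePreserving_equivPiIoc (a := 0)))

theorem setAverage_cell_eq_integral_torus {F : Type*} [NormedAddCommGroup F] [NormedSpace ℝ F]
    {f : (Fin d → ℝ) → F} (hf : AEStronglyMeasurable f (volume.restrict (cell d))) :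
    ⨍ y in cell d, f y = ∫ t, f (torusSection d t) := by
  have h := measurePreserving_torusSection d
  rw [setAverage_eq', ← h.map_eq, integral_map h.aemeasurable]
  rw [h.map_eq]
  exact hf.smul_measure _

theorem memLp_comp_torusSection (u : L2 d) :
    MemLp (fun t => u (torusSection d t)) 2 (volume : Measure (UnitAddTorus (Fin d))) :=
  ((Lp.memLp u).smul_measure (ENNReal.inv_ne_top.2 (volume_cell_ne_zero d))).comp_measurePreserving
    (measurePreserving_torusSection d)

theorem mFourierCoeff_toLp_comp_torusSection (u : L2 d) (n : Fin d → ℤ) :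
    UnitAddTorus.mFourierCoeff ((memLp_comp_torusSection u).toLp _) n = fourierCoeff u n := by
  rw [fourierCoeff, cellMean, setAverage_cell_eq_integral_torus (integrable_mul_fourierMode u n).1,
    UnitAddTorus.mFourierCoeff]
  refine integral_congr_ae ?_
  filter_upwards [(memLp_comp_torusSection u).coeFn_toLp] with t ht
  rw [ht, UnitAddTorus.mFourier_neg, mFourier_eq_fourierMode, smul_eq_mul, mul_comm]

theorem norm_sq_L2 (f : L2 d) : ‖f‖ ^ 2 = ∫ y in cell d, ‖f y‖ ^ 2 := by
  rw [← inner_self_eq_norm_sq (𝕜 := ℂ) f, L2.inner_def, ← integral_re (L2.integrable_inner f f)]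
  simp [← Complex.ofReal_pow]

theorem hasSum_sq_fourierCoeff (u : L2 d) :
    HasSum (fun n => ‖fourierCoeff u n‖ ^ 2) ((volume.real (cell d))⁻¹ * ‖u‖ ^ 2) := by
  have h := UnitAddTorus.hasSum_sq_mFourierCoeff ((memLp_comp_torusSection u).toLp _)
  have hmeas : AEStronglyMeasurable (fun y => ‖u y‖ ^ 2) (volume.restrict (cell d)) :=
    (Lp.aestronglyMeasurable u).norm.pow 2
  have hnorm : ∫ t, ‖(memLp_comp_torusSection u).toLp _ t‖ ^ 2 =
      (volume.real (cell d))⁻¹ * ‖u‖ ^ 2 := by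
    rw [norm_sq_L2, ← measureReal_restrict_apply_univ, ← smul_eq_mul, ← average_eq,
      setAverage_cell_eq_integral_torus hmeas]
    refine integral_congr_ae ?_
    filter_upwards [(memLp_comp_torusSection u).coeFn_toLp] with t ht
    rw [ht]
  simpa only [mFourierCoeff_toLp_comp_torusSection, hnorm] using h

end Parseval

theorem eq_zero_of_fourierCoeff_eq_zero {u : L2 d} (h : ∀ n, fourierCoeff u n = 0) : u = 0 := by
  have hsum : HasSum (fun _ : Fin d → ℤ => (0 : ℝ)) ((volume.real (cell d))⁻¹ * ‖u‖ ^ 2) := by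
    simpa [h] using hasSum_sq_fourierCoeff u
  simpa [(volume_real_cell_pos d).ne'] using hsum.unique hasSum_zero

theorem inner_L2 (f g : L2 d) : ⟪f, g⟫_ℂ = ∫ y in cell d, g y * conj (f y) := by
  rw [L2.inner_def]
  simp only [RCLike.inner_apply]

theorem cellMean_eq_integral (f : (Fin d → ℝ) → ℂ) :
    cellMean f = (volume.real (cell d) : ℂ)⁻¹ * ∫ y in cell d, f y := by
  rw [cellMean, setAverage_eq, Complex.real_smul, Complex.ofReal_inv]

theorem cellMean_congr_ae {f g : (Fin d → ℝ) → ℂ} (h : f =ᵐ[volume.restrict (cell d)] g) :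
    cellMean f = cellMean g := by
  rw [cellMean_eq_integral, cellMean_eq_integral, integral_congr_ae h]

theorem memLp_fourierMode (n : Fin d → ℤ) :
    MemLp (fourierMode n) 2 ((volume : Measure (Fin d → ℝ)).restrict (cell d)) :=
  MemLp.of_bound (continuous_fourierMode n).aestronglyMeasurable 1
    (Eventually.of_forall fun y => (norm_fourierMode n y).le)

theorem fourierCoeff_eq_inner (u : L2 d) (n : Fin d → ℤ) :
    fourierCoeff u n =
      (volume.real (cell d) : ℂ)⁻¹ * ⟪(memLp_fourierMode n).toLp (fourierMode n), u⟫_ℂ := by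
  rw [fourierCoeff, cellMean_eq_integral, inner_L2]
  congr 1
  refine integral_congr_ae ?_
  filter_upwards [(memLp_fourierMode n).coeFn_toLp] with y hy
  rw [hy]

theorem continuous_fourierCoeff (n : Fin d → ℤ) :
    Continuous fun u : L2 d => fourierCoeff u n := by
  simp_rw [fourierCoeff_eq_inner]
  fun_prop

theorem fourierCoeff_sum {ι : Type*} (s : Finset ι) (f : ι → L2 d) (n : Fin d → ℤ) :
    fourierCoeff (∑ i ∈ s, f i) n = ∑ i ∈ s, fourierCoeff (f i) n := by
  simp_rw [fourierCoeff_eq_inner, inner_sum, Finset.mul_sum]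

/-- The constant function `1` in `L²_♯(Y)`. -/
def oneL2 (d : ℕ) : L2 d := Lp.const 2 _ 1

theorem coeFn_oneL2 (d : ℕ) : oneL2 d =ᵐ[volume.restrict (cell d)] fun _ => 1 :=
  Lp.coeFn_const ..

/-- The mean value `M_Y` as a functional on `L²_♯(Y)`. -/
def meanL2 (d : ℕ) : L2 d →L[ℂ] ℂ :=
  (volume.real (cell d) : ℂ)⁻¹ • innerSL ℂ (oneL2 d)

theorem meanL2_eq_cellMean (u : L2 d) : meanL2 d u = cellMean u := by
  change _ * ⟪oneL2 d, u⟫_ℂ = _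
  rw [cellMean_eq_integral, inner_L2]
  congr 1
  refine integral_congr_ae ?_
  filter_upwards [coeFn_oneL2 d] with y hy
  rw [hy, map_one, mul_one]

theorem inner_oneL2 (u : L2 d) : ⟪oneL2 d, u⟫_ℂ = volume.real (cell d) * meanL2 d u :=
  (mul_inv_cancel_left₀ (Complex.ofReal_ne_zero.2 (volume_real_cell_pos d).ne') _).symm

theorem meanL2_oneL2 : meanL2 d (oneL2 d) = 1 := by
  have : NeZero (volume.restrict (cell d)) :=
    ⟨Measure.restrict_eq_zero.not.2 (volume_cell_ne_zero d)⟩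
  rw [meanL2_eq_cellMean, cellMean_congr_ae (coeFn_oneL2 d), cellMean, average_const]

theorem norm_sq_oneL2 : ‖oneL2 d‖ ^ 2 = volume.real (cell d) := by
  have h := inner_oneL2 (oneL2 d)
  rw [meanL2_oneL2, mul_one, inner_self_eq_norm_sq_to_K] at h
  exact Complex.ofReal_injective (by simpa using h)

theorem fourierCoeff_zero_right (u : L2 d) : fourierCoeff u 0 = meanL2 d u := by
  simp [meanL2_eq_cellMean, fourierCoeff, fourierMode]

theorem fourierCoeff_oneL2 {n : Fin d → ℤ} (hn : n ≠ 0) : fourierCoeff (oneL2 d) n = 0 := by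
  -- The coefficient at `0` already exhausts the norm in Parseval's identity.
  have hsum := hasSum_sq_fourierCoeff (oneL2 d)
  rw [norm_sq_oneL2, inv_mul_cancel₀ (volume_real_cell_pos d).ne'] at hsum
  have hpair := sum_le_hasSum {0, n} (fun _ _ => sq_nonneg _) hsum
  rw [Finset.sum_pair hn.symm, fourierCoeff_zero_right, meanL2_oneL2, norm_one, one_pow] at hpair
  have hle : ‖fourierCoeff (oneL2 d) n‖ ^ 2 ≤ 0 := by linarith
  simpa using le_antisymm hle (sq_nonneg _)

theorem isClosed_setOf_isPartialDeriv (j : Fin d) (a b : JetIndex d) :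
    IsClosed {w : PiLp 2 fun _ : JetIndex d => L2 d | IsPartialDeriv j (w a) (w b)} := by
  simp only [IsPartialDeriv, Set.ofPred_forall]
  exact isClosed_iInter fun n => isClosed_eq
    ((continuous_fourierCoeff n).comp (PiLp.continuous_apply 2 _ b))
    (continuous_const.mul ((continuous_fourierCoeff n).comp (PiLp.continuous_apply 2 _ a)))

theorem isClosed_sobolevH2 (d : ℕ) :
    IsClosed (sobolevH2 d : Set (PiLp 2 fun _ : JetIndex d => L2 d)) := by
  have h : (sobolevH2 d : Set (PiLp 2 fun _ : JetIndex d => L2 d)) =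
      (⋂ j, {w | IsPartialDeriv j (w (.inl ())) (w (.inr (.inl j)))}) ∩
      ⋂ j, ⋂ k, {w | IsPartialDeriv k (w (.inr (.inl j))) (w (.inr (.inr (j, k))))} := by
    ext w
    simp [sobolevH2]
  rw [h]
  exact (isClosed_iInter fun j => isClosed_setOf_isPartialDeriv _ _ _).inter
    (isClosed_iInter fun j => isClosed_iInter fun k => isClosed_setOf_isPartialDeriv _ _ _)

instance : CompleteSpace (H2 d) := (isClosed_sobolevH2 d).completeSpace_coe

/-- The Hilbert space `L²_♯(Y)^d` of square integrable vector fields. -/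
abbrev L2Field (d : ℕ) : Type := PiLp 2 fun _ : Fin d => L2 d

theorem quarter_le_sq_int_add {n : ℤ} (hn : n ≠ 0) {t : ℝ} (ht : |t| ≤ 1 / 2) :
    1 / 4 ≤ ((n : ℝ) + t) ^ 2 := by
  have hone : (1 : ℝ) ≤ |(n : ℝ)| := by exact_mod_cast Int.one_le_abs hn
  have hhalf : 1 / 2 ≤ |(n : ℝ) + t| := by linarith [abs_sub_abs_le_abs_add (n : ℝ) t]
  rw [← sq_abs]
  nlinarith

namespace H2

/-- The component `a` of the jet `(u, ∂_j u, ∂_j ∂_k u)` of `u ∈ H²_♯(Y)`, as an operator into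
`L²_♯(Y)`. -/
def jetL (a : JetIndex d) : H2 d →L[ℂ] L2 d :=
  PiLp.proj 2 (fun _ : JetIndex d => L2 d) a ∘L (sobolevH2 d).subtypeL

/-- The embedding `H²_♯(Y) → L²_♯(Y)`. -/
def toL2L (d : ℕ) : H2 d →L[ℂ] L2 d := jetL (.inl ())

/-- The gradient as an operator `H²_♯(Y) → L²_♯(Y)^d`. -/
def gradL (d : ℕ) : H2 d →L[ℂ] L2Field d :=
  (PiLp.continuousLinearEquiv 2 ℂ fun _ : Fin d => L2 d).symm.toContinuousLinearMap ∘L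
    ContinuousLinearMap.pi fun j => jetL (.inr (.inl j))

/-- The Laplacian as an operator `H²_♯(Y) → L²_♯(Y)`. -/
def laplacianL (d : ℕ) : H2 d →L[ℂ] L2 d := ∑ j, jetL (.inr (.inr (j, j)))

theorem toL2L_apply (u : H2 d) : toL2L d u = u.toL2 := rfl

theorem gradL_apply (u : H2 d) (j : Fin d) : gradL d u j = u.grad j := rfl

theorem laplacianL_apply (u : H2 d) : laplacianL d u = u.laplacian := by
  rw [laplacianL, sum_apply]
  rfl

/-- The constant function `1` in `H²_♯(Y)`. -/
def one (d : ℕ) : H2 d :=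
  ⟨WithLp.toLp 2 (Sum.elim (fun _ => oneL2 d) fun _ => 0), by
    refine ⟨fun j n => ?_, fun j k n => ?_⟩
    · change fourierCoeff (0 : L2 d) n = _ * fourierCoeff (oneL2 d) n
      rw [fourierCoeff_zero]
      by_cases hn : n = 0
      · simp [hn]
      · rw [fourierCoeff_oneL2 hn, mul_zero]
    · change fourierCoeff (0 : L2 d) n = _ * fourierCoeff (0 : L2 d) n
      rw [fourierCoeff_zero, mul_zero]⟩

theorem toL2L_one : toL2L d (one d) = oneL2 d := rfl

theorem gradL_one : gradL d (one d) = 0 := rfl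

theorem laplacianL_one : laplacianL d (one d) = 0 := by
  rw [laplacianL_apply]
  exact Finset.sum_eq_zero fun _ _ => rfl

/-- The mean value `M_Y` as a functional on `H²_♯(Y)`. -/
def mean (d : ℕ) : H2 d →L[ℂ] ℂ := meanL2 d ∘L toL2L d

theorem mean_apply (u : H2 d) : mean d u = meanL2 d (toL2L d u) := rfl

theorem mean_eq_cellMean (u : H2 d) : mean d u = cellMean u.toL2 := meanL2_eq_cellMean _

theorem mean_one : mean d (one d) = 1 := meanL2_oneL2

theorem fourierCoeff_grad (u : H2 d) (j : Fin d) (n : Fin d → ℤ) :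
    fourierCoeff (u.grad j) n = Complex.I * (n j : ℂ) * fourierCoeff u.toL2 n :=
  u.2.1 j n

theorem fourierCoeff_hess (u : H2 d) (j k : Fin d) (n : Fin d → ℤ) :
    fourierCoeff (u.hess j k) n = -((n j : ℂ) * (n k : ℂ)) * fourierCoeff u.toL2 n := by
  have h : fourierCoeff (u.hess j k) n = Complex.I * (n k : ℂ) * fourierCoeff (u.grad j) n :=
    u.2.2 j k n
  rw [h, fourierCoeff_grad]
  linear_combination (n j : ℂ) * (n k : ℂ) * fourierCoeff u.toL2 n * Complex.I_sq

theorem fourierCoeff_laplacian (u : H2 d) (n : Fin d → ℤ) :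
    fourierCoeff u.laplacian n = -(∑ j, (n j : ℂ) ^ 2) * fourierCoeff u.toL2 n := by
  rw [laplacian, fourierCoeff_sum, ← Finset.sum_neg_distrib, Finset.sum_mul]
  refine Finset.sum_congr rfl fun j _ => ?_
  rw [fourierCoeff_hess, sq]

theorem fourierCoeff_shiftedGrad (η : EuclideanSpace ℝ (Fin d)) (u : H2 d) (j : Fin d)
    (n : Fin d → ℤ) :
    fourierCoeff (shiftedGrad η u j) n =
      Complex.I * ((n j + η j : ℝ) : ℂ) * fourierCoeff u.toL2 n := by
  rw [shiftedGrad, fourierCoeff_add, fourierCoeff_smul, fourierCoeff_grad]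
  push_cast
  ring

theorem norm_sq_eq (u : H2 d) :
    ‖u‖ ^ 2 = ‖u.toL2‖ ^ 2 + (∑ j, ‖u.grad j‖ ^ 2 + ∑ j, ∑ k, ‖u.hess j k‖ ^ 2) := by
  have h := PiLp.norm_sq_eq_of_L2 (fun _ : JetIndex d => L2 d) u.1
  rw [Fintype.sum_sum_type, Fintype.sum_sum_type, Fintype.sum_prod_type, Fintype.sum_unique] at h
  exact h

theorem sq_norm_fourierCoeff_le_shiftedGrad {η : EuclideanSpace ℝ (Fin d)}
    (hη : ∀ j, |η j| ≤ 1 / 2) (u : H2 d) {n : Fin d → ℤ} (hn : n ≠ 0) :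
    ‖fourierCoeff u.toL2 n‖ ^ 2 ≤ 4 * ∑ j, ‖fourierCoeff (shiftedGrad η u j) n‖ ^ 2 := by
  obtain ⟨j, hj⟩ : ∃ j, n j ≠ 0 := Function.ne_iff.1 hn
  have hle := Finset.single_le_sum
    (f := fun i => ‖fourierCoeff (shiftedGrad η u i) n‖ ^ 2) (fun _ _ => sq_nonneg _)
    (Finset.mem_univ j)
  have hcoeff : ‖fourierCoeff (shiftedGrad η u j) n‖ ^ 2 =
      ((n j : ℝ) + η j) ^ 2 * ‖fourierCoeff u.toL2 n‖ ^ 2 := by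
    rw [fourierCoeff_shiftedGrad, norm_mul, norm_mul, Complex.norm_I, one_mul, mul_pow,
      Complex.norm_real, Real.norm_eq_abs, sq_abs]
  have hgap := mul_le_mul_of_nonneg_right (quarter_le_sq_int_add hj (hη j))
    (sq_nonneg ‖fourierCoeff u.toL2 n‖)
  simp only [hcoeff] at hle
  linarith

theorem norm_sq_toL2_le {η : EuclideanSpace ℝ (Fin d)} (hη : ∀ j, |η j| ≤ 1 / 2) (u : H2 d) :
    ‖u.toL2‖ ^ 2 ≤ volume.real (cell d) * ‖mean d u‖ ^ 2 + 4 * ∑ j, ‖shiftedGrad η u j‖ ^ 2 := by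
  have hV := volume_real_cell_pos d
  have hgrad := hasSum_sum fun j (_ : j ∈ Finset.univ) => hasSum_sq_fourierCoeff (shiftedGrad η u j)
  have hle := hasSum_le (fun n => ?_) (hasSum_sq_fourierCoeff u.toL2)
    ((hasSum_ite_eq (0 : Fin d → ℤ) (‖mean d u‖ ^ 2)).add (hgrad.mul_left 4))
  · rw [← Finset.mul_sum] at hle
    calc ‖u.toL2‖ ^ 2 = volume.real (cell d) * ((volume.real (cell d))⁻¹ * ‖u.toL2‖ ^ 2) := by
          field_simp
      _ ≤ _ := mul_le_mul_of_nonneg_left hle hV.le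
      _ = _ := by field_simp
  · split_ifs with hn
    · rw [hn, fourierCoeff_zero_right, mean_apply, toL2L_apply]
      exact le_add_of_nonneg_right (by positivity)
    · rw [zero_add]
      exact sq_norm_fourierCoeff_le_shiftedGrad hη u hn

theorem sum_norm_sq_hess (u : H2 d) : ∑ j, ∑ k, ‖u.hess j k‖ ^ 2 = ‖u.laplacian‖ ^ 2 := by
  have hhess := hasSum_sum fun j (_ : j ∈ Finset.univ) =>
    hasSum_sum fun k (_ : k ∈ Finset.univ) => hasSum_sq_fourierCoeff (u.hess j k)
  simp_rw [← Finset.mul_sum] at hhess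
  refine mul_left_cancel₀ (inv_ne_zero (volume_real_cell_pos d).ne')
    ((hhess.congr_fun fun n => ?_).unique (hasSum_sq_fourierCoeff u.laplacian))
  have hcast : ‖∑ j, (n j : ℂ) ^ 2‖ = ∑ j, (n j : ℝ) ^ 2 := by
    rw [← Real.norm_of_nonneg (Finset.sum_nonneg fun j _ => sq_nonneg (n j : ℝ)),
      ← Complex.norm_real]
    push_cast
    rfl
  simp_rw [fourierCoeff_laplacian, fourierCoeff_hess, norm_mul, norm_neg, hcast, norm_mul,
    mul_pow, Complex.norm_intCast, sq_abs, ← Finset.sum_mul]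
  rw [sq (∑ j, (n j : ℝ) ^ 2), Finset.sum_mul_sum]

theorem norm_sq_le (u : H2 d) :
    ‖u‖ ^ 2 ≤ volume.real (cell d) * ‖mean d u‖ ^ 2 + 5 * ‖gradL d u‖ ^ 2 +
      ‖laplacianL d u‖ ^ 2 := by
  have h := norm_sq_toL2_le (η := 0) (by simp) u
  simp only [shiftedGrad, PiLp.zero_apply, Complex.ofReal_zero, mul_zero, zero_smul, add_zero] at h
  rw [norm_sq_eq, sum_norm_sq_hess, PiLp.norm_sq_eq_of_L2, laplacianL_apply]
  simp only [gradL_apply]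
  linarith

theorem toL2L_injective : Function.Injective (toL2L d) := by
  refine (injective_iff_map_eq_zero _).2 fun u hu => ?_
  have hu0 : u.toL2 = 0 := hu
  have hcoeff : ∀ n, fourierCoeff u.toL2 n = 0 := fun n => by rw [hu0, fourierCoeff_zero]
  have hgrad : ∀ j, u.grad j = 0 := fun j => eq_zero_of_fourierCoeff_eq_zero fun n => by
    rw [fourierCoeff_grad, hcoeff, mul_zero]
  have hhess : ∀ j k, u.hess j k = 0 := fun j k => eq_zero_of_fourierCoeff_eq_zero fun n => by
    rw [fourierCoeff_hess, hcoeff, mul_zero]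
  have hnorm := norm_sq_eq u
  simpa [hu0, hgrad, hhess] using hnorm

end H2

section Coefficients

variable {A : (Fin d → ℝ) → Matrix (Fin d) (Fin d) ℝ}

theorem integrable_sum_mul_conj (p q : L2Field d) :
    Integrable (fun y => ∑ j, q j y * conj (p j y)) (volume.restrict (cell d)) :=
  integrable_finsetSum _ fun j _ => by simpa using L2.integrable_inner (𝕜 := ℂ) (p j) (q j)

theorem inner_L2Field (p q : L2Field d) :
    ⟪p, q⟫_ℂ = ∫ y in cell d, ∑ j, q j y * conj (p j y) := by
  rw [integral_finsetSum _ fun j _ => by simpa using L2.integrable_inner (𝕜 := ℂ) (p j) (q j),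
    PiLp.inner_apply]
  simp only [inner_L2]

theorem IsCoefficient.memLp_entry (hA : IsCoefficient A) (j k : Fin d) :
    MemLp (fun y => (A y j k : ℂ)) ∞ (volume.restrict (cell d)) := by
  obtain ⟨C, hC⟩ := hA.bounded
  refine MemLp.of_bound (C := C) (Complex.measurable_ofReal.comp_aemeasurable
    (hA.measurable j k).restrict).aestronglyMeasurable ?_
  filter_upwards [ae_restrict_of_ae (hC j k)] with y hy
  rwa [Complex.norm_real]

/-- Multiplication by the coefficient `a_{jk}` on `L²_♯(Y)`. -/
def coeffMul (hA : IsCoefficient A) (j k : Fin d) : L2 d →L[ℂ] L2 d :=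
  (ContinuousLinearMap.mul ℂ ℂ).holderL (volume.restrict (cell d)) ∞ 2 2
    ((hA.memLp_entry j k).toLp _)

theorem coeFn_coeffMul (hA : IsCoefficient A) (j k : Fin d) (f : L2 d) :
    coeffMul hA j k f =ᵐ[volume.restrict (cell d)] fun y => (A y j k : ℂ) * f y := by
  filter_upwards [(ContinuousLinearMap.mul ℂ ℂ).coeFn_holder (r := 2)
    ((hA.memLp_entry j k).toLp _) f, (hA.memLp_entry j k).coeFn_toLp] with y hmul hentry
  rw [coeffMul, ContinuousLinearMap.holderL_apply_apply, hmul, hentry]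
  rfl

/-- Multiplication by the coefficient matrix `A` on `L²_♯(Y)^d`. -/
def coeffOp (hA : IsCoefficient A) : L2Field d →L[ℂ] L2Field d :=
  (PiLp.continuousLinearEquiv 2 ℂ fun _ : Fin d => L2 d).symm.toContinuousLinearMap ∘L
    ContinuousLinearMap.pi fun j => ∑ k, coeffMul hA j k ∘L PiLp.proj 2 _ k

theorem coeFn_coeffOp (hA : IsCoefficient A) (q : L2Field d) (j : Fin d) :
    coeffOp hA q j =ᵐ[volume.restrict (cell d)] fun y => ∑ k, (A y j k : ℂ) * q k y := by
  have happly : coeffOp hA q j = ∑ k, coeffMul hA j k (q k) := by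
    change (∑ k, coeffMul hA j k ∘L PiLp.proj 2 _ k : L2Field d →L[ℂ] L2 d) q = _
    rw [sum_apply]
    rfl
  rw [happly]
  filter_upwards [Lp.coeFn_finsetSum Finset.univ fun k => coeffMul hA j k (q k),
    ae_all_iff.2 fun k => coeFn_coeffMul hA j k (q k)] with y hsum hmul
  simp only [hsum, Finset.sum_apply, hmul]

theorem inner_coeffOp (hA : IsCoefficient A) (p q : L2Field d) :
    ⟪p, coeffOp hA q⟫_ℂ =
      ∫ y in cell d, ∑ j, ∑ k, (A y j k : ℂ) * q k y * conj (p j y) := by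
  rw [inner_L2Field]
  refine integral_congr_ae ?_
  filter_upwards [ae_all_iff.2 fun j => coeFn_coeffOp hA q j] with y hy
  simp only [hy, Finset.sum_mul]

theorem coeffOp_isSymmetric (hA : IsCoefficient A) :
    (coeffOp hA : L2Field d →ₗ[ℂ] L2Field d).IsSymmetric := by
  intro p q
  change ⟪coeffOp hA p, q⟫_ℂ = ⟪p, coeffOp hA q⟫_ℂ
  rw [← inner_conj_symm, inner_coeffOp, inner_coeffOp, ← integral_conj]
  refine integral_congr_ae ?_
  filter_upwards [ae_restrict_of_ae hA.symmetric] with y hy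
  simp only [map_sum, map_mul, Complex.conj_conj, Complex.conj_ofReal]
  rw [Finset.sum_comm]
  refine Finset.sum_congr rfl fun j _ => Finset.sum_congr rfl fun k _ => ?_
  rw [hy.apply]
  ring

theorem re_sum_mul_conj_ge {M : Matrix (Fin d) (Fin d) ℝ} {α : ℝ}
    (hM : ∀ ξ : Fin d → ℝ, α * ∑ j, ξ j ^ 2 ≤ ∑ j, ∑ k, M j k * ξ k * ξ j) (z : Fin d → ℂ) :
    α * ∑ j, ‖z j‖ ^ 2 ≤ (∑ j, ∑ k, (M j k : ℂ) * z k * conj (z j)).re := by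
  have hnorm : ∑ j, ‖z j‖ ^ 2 = ∑ j, (z j).re ^ 2 + ∑ j, (z j).im ^ 2 := by
    simp only [← Finset.sum_add_distrib, Complex.sq_norm, Complex.normSq_apply, ← sq]
  have hform : (∑ j, ∑ k, (M j k : ℂ) * z k * conj (z j)).re =
      ∑ j, ∑ k, M j k * (z k).re * (z j).re + ∑ j, ∑ k, M j k * (z k).im * (z j).im := by
    simp [Complex.re_sum, ← Finset.sum_add_distrib]
  rw [hnorm, hform, mul_add]
  exact add_le_add (hM fun j => (z j).re) (hM fun j => (z j).im)

theorem re_inner_coeffOp_ge (hA : IsCoefficient A) {α : ℝ}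
    (hα : ∀ᵐ y, ∀ ξ : Fin d → ℝ, α * ∑ j, ξ j ^ 2 ≤ ∑ j, ∑ k, A y j k * ξ k * ξ j)
    (p : L2Field d) : α * ‖p‖ ^ 2 ≤ (⟪p, coeffOp hA p⟫_ℂ).re := by
  have hnorm : ‖p‖ ^ 2 = (⟪p, p⟫_ℂ).re := norm_sq_eq_re_inner (𝕜 := ℂ) p
  have hint := integrable_sum_mul_conj p p
  have hintA := integrable_sum_mul_conj p (coeffOp hA p)
  rw [hnorm, inner_L2Field, inner_L2Field]
  change α * RCLike.re (∫ y in cell d, ∑ j, p j y * conj (p j y)) ≤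
    RCLike.re (∫ y in cell d, ∑ j, coeffOp hA p j y * conj (p j y))
  rw [← integral_re hint, ← integral_re hintA, ← integral_const_mul]
  refine integral_mono_ae (hint.re.const_mul α) hintA.re ?_
  filter_upwards [ae_restrict_of_ae hα, ae_all_iff.2 fun j => coeFn_coeffOp hA p j] with y hy hAp
  have hlower := re_sum_mul_conj_ge hy fun j => p j y
  simpa [hAp, Finset.sum_mul, Complex.mul_conj, Complex.normSq_eq_norm_sq, Complex.re_sum,
    ← Complex.ofReal_pow] using hlower

/-- The constant vector field `e_l`. -/
def constField (l : Fin d) : L2Field d := PiLp.single 2 l (oneL2 d)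

theorem coeFn_constField (l j : Fin d) :
    constField l j =ᵐ[volume.restrict (cell d)] fun _ => if j = l then 1 else 0 := by
  rw [constField, PiLp.single_apply]
  split_ifs with hj
  · exact coeFn_oneL2 d
  · exact Lp.coeFn_zero _ _ _

theorem inner_constField (l : Fin d) (p : L2Field d) :
    ⟪constField l, p⟫_ℂ = volume.real (cell d) * meanL2 d (p l) := by
  rw [← inner_oneL2, PiLp.inner_apply, Finset.sum_eq_single l]
  · simp [constField]
  · intro j _ hj
    simp [constField, hj]
  · simp

theorem coeFn_constField_add (l : Fin d) (p : L2Field d) :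
    ∀ᵐ y ∂volume.restrict (cell d), ∀ k,
      (constField l + p) k y = (if k = l then 1 else 0) + p k y :=
  ae_all_iff.2 fun k => by
    filter_upwards [Lp.coeFn_add (constField l k) (p k), coeFn_constField l k] with y hadd hconst
    rw [PiLp.add_apply, hadd, Pi.add_apply, hconst]

theorem homogenizedMatrix_eq_inner (hA : IsCoefficient A) (χ : Fin d → H2 d) (k l : Fin d) :
    volume.real (cell d) * homogenizedMatrix A χ k l =
      ⟪constField k, coeffOp hA (constField l + H2.gradL d (χ l))⟫_ℂ := by
  rw [inner_constField, homogenizedMatrix, meanL2_eq_cellMean]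
  congr 1
  refine cellMean_congr_ae ?_
  filter_upwards [coeFn_coeffOp hA (constField l + H2.gradL d (χ l)) k,
    coeFn_constField_add l (H2.gradL d (χ l))] with y hop hfield
  rw [hop]
  simp only [hfield, mul_add, Finset.sum_add_distrib, mul_ite, mul_one, mul_zero,
    Finset.sum_ite_eq', Finset.mem_univ, if_true, H2.gradL_apply]

end Coefficients

section EnergyOperator

open ContinuousLinearMap (adjoint)

variable {𝕜 E F K : Type*} [RCLike 𝕜]
  [NormedAddCommGroup E] [InnerProductSpace 𝕜 E] [CompleteSpace E]
  [NormedAddCommGroup F] [InnerProductSpace 𝕜 F] [CompleteSpace F]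
  [NormedAddCommGroup K] [InnerProductSpace 𝕜 K] [CompleteSpace K]

/-- The operator `T* S T + r D* D`, which represents the sesquilinear form
`⟪T v, S (T u)⟫ + r ⟪D v, D u⟫`. -/
def energyOp (S : F →L[𝕜] F) (r : ℝ) (T : E →L[𝕜] F) (D : E →L[𝕜] K) : E →L[𝕜] E :=
  adjoint T ∘L S ∘L T + (r : 𝕜) • (adjoint D ∘L D)

variable {S : F →L[𝕜] F} {r : ℝ} {T : E →L[𝕜] F} {D : E →L[𝕜] K}

theorem energyOp_apply (u : E) :
    energyOp S r T D u = adjoint T (S (T u)) + (r : 𝕜) • adjoint D (D u) := rfl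

theorem inner_energyOp (u v : E) :
    ⟪v, energyOp S r T D u⟫_𝕜 = ⟪T v, S (T u)⟫_𝕜 + r * ⟪D v, D u⟫_𝕜 := by
  rw [energyOp_apply, inner_add_right, inner_smul_right, ContinuousLinearMap.adjoint_inner_right,
    ContinuousLinearMap.adjoint_inner_right]

theorem energyOp_isSymmetric (hS : (S : F →ₗ[𝕜] F).IsSymmetric) :
    (energyOp S r T D : E →ₗ[𝕜] E).IsSymmetric := by
  intro u v
  change ⟪energyOp S r T D u, v⟫_𝕜 = ⟪u, energyOp S r T D v⟫_𝕜
  rw [← inner_conj_symm, inner_energyOp, inner_energyOp, map_add, map_mul, inner_conj_symm,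
    inner_conj_symm, RCLike.conj_ofReal, hS.apply_clm]

theorem re_inner_energyOp_ge {α : ℝ} (hS : ∀ p, α * ‖p‖ ^ 2 ≤ RCLike.re ⟪p, S p⟫_𝕜) (u : E) :
    α * ‖T u‖ ^ 2 + r * ‖D u‖ ^ 2 ≤ RCLike.re ⟪u, energyOp S r T D u⟫_𝕜 := by
  rw [inner_energyOp, map_add, RCLike.re_ofReal_mul, ← norm_sq_eq_re_inner]
  exact add_le_add_left (hS (T u)) _

variable [NormedSpace ℝ E] [IsScalarTower ℝ 𝕜 E] [NormedSpace ℝ F] [IsScalarTower ℝ 𝕜 F]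
  [NormedSpace ℝ K] [IsScalarTower ℝ 𝕜 K] {G : Type*} [NormedAddCommGroup G] [NormedSpace ℝ G]
  {n : WithTop ℕ∞} {x : G}

theorem contDiffAt_adjoint {T : G → E →L[𝕜] F} (hT : ContDiffAt ℝ n T x) :
    ContDiffAt ℝ n (fun y => adjoint (T y)) x := by
  let adjointL : (E →L[𝕜] F) →L[ℝ] (F →L[𝕜] E) :=
    { toFun := adjoint
      map_add' := map_add _
      map_smul' := fun s R => by
        rw [← algebraMap_smul 𝕜 s R, map_smulₛₗ, RingHom.id_apply,
          ← algebraMap_smul 𝕜 s (adjoint R)]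
        simp
      cont := (adjoint (𝕜 := 𝕜) (E := E) (F := F)).continuous }
  exact adjointL.contDiff.contDiffAt.comp x hT

theorem contDiffAt_energyOp {T : G → E →L[𝕜] F} {D : G → E →L[𝕜] K} (hT : ContDiffAt ℝ n T x)
    (hD : ContDiffAt ℝ n D x) : ContDiffAt ℝ n (fun y => energyOp S r (T y) (D y)) x :=
  (contDiffAt_clm_comp (contDiffAt_adjoint hT) (contDiffAt_clm_comp contDiffAt_const hT)).add
    ((contDiffAt_clm_comp (contDiffAt_adjoint hD) hD).const_smul (r : 𝕜))

theorem partialEta_energyOp_apply {η : EuclideanSpace ℝ (Fin d)}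
    {T : EuclideanSpace ℝ (Fin d) → E →L[𝕜] F} {D : EuclideanSpace ℝ (Fin d) → E →L[𝕜] K}
    {u : EuclideanSpace ℝ (Fin d) → E} (hT : ContDiffAt ℝ 1 T η) (hD : ContDiffAt ℝ 1 D η)
    (hu : ContDiffAt ℝ 1 u η) (hTu : T η (u η) = 0) (hDu : D η (u η) = 0) (l : Fin d) :
    partialEta l (fun x => energyOp S r (T x) (D x) (u x)) η =
      adjoint (T η) (S (partialEta l (fun x => T x (u x)) η)) +
        (r : 𝕜) • adjoint (D η) (partialEta l (fun x => D x (u x)) η) := by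
  have hTu' := contDiffAt_clm_apply hT hu
  have hDu' := contDiffAt_clm_apply hD hu
  have hST := contDiffAt_clm_comp (contDiffAt_adjoint hT) (contDiffAt_const (c := S))
  have hrD := (contDiffAt_adjoint hD).const_smul (r : 𝕜)
  calc partialEta l (fun x => energyOp S r (T x) (D x) (u x)) η
      = partialEta l (fun x => (adjoint (T x) ∘L S) (T x (u x))) η +
          partialEta l (fun x => ((r : 𝕜) • adjoint (D x)) (D x (u x))) η :=
        partialEta_add ((contDiffAt_clm_apply hST hTu').differentiableAt one_ne_zero)
          ((contDiffAt_clm_apply hrD hDu').differentiableAt one_ne_zero) l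
    _ = _ := by
        rw [partialEta_clm_apply (hST.differentiableAt one_ne_zero)
            (hTu'.differentiableAt one_ne_zero),
          partialEta_clm_apply (hrD.differentiableAt one_ne_zero)
            (hDu'.differentiableAt one_ne_zero),
          hTu, hDu, map_zero, map_zero, add_zero, add_zero]
        rfl

end EnergyOperator

/- On `ℂ`-valued objects this instance competes with the inner product of the Hilbert spaces below
and makes rewriting with `inner` lemmas fail. -/
attribute [-instance] WithCStarModule.instCStarModuleComplex

section BlochOperator

open ContinuousLinearMap (adjoint)

variable {A : (Fin d → ℝ) → Matrix (Fin d) (Fin d) ℝ} {η : EuclideanSpace ℝ (Fin d)}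

/-- The vector field `f e_j` with one component `f ∈ L²_♯(Y)`. -/
def singleL (j : Fin d) : L2 d →L[ℂ] L2Field d :=
  (PiLp.continuousLinearEquiv 2 ℂ fun _ : Fin d => L2 d).symm.toContinuousLinearMap ∘L
    ContinuousLinearMap.single ℂ (fun _ : Fin d => L2 d) j

theorem singleL_oneL2 (j : Fin d) : singleL j (oneL2 d) = constField j := rfl

namespace H2

/-- `∇ + iη` as an operator `H²_♯(Y) → L²_♯(Y)^d`, written so that its dependence on `η` is
visibly analytic. -/
def shiftedGradL (η : EuclideanSpace ℝ (Fin d)) : H2 d →L[ℂ] L2Field d :=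
  gradL d + ∑ j, η j • (Complex.I • singleL j ∘L toL2L d)

/-- `(∇ + iη)²` as an operator `H²_♯(Y) → L²_♯(Y)`, with the terms of degree at least one in `η`
collected by coordinates. -/
def shiftedLaplacianL (η : EuclideanSpace ℝ (Fin d)) : H2 d →L[ℂ] L2 d :=
  laplacianL d + ∑ j, η j • ((2 * Complex.I) • jetL (.inr (.inl j)) - η j • toL2L d)

theorem shiftedGradL_apply (u : H2 d) :
    shiftedGradL η u = gradL d u + ∑ j, η j • (Complex.I • singleL j (toL2L d u)) := by
  rw [shiftedGradL, add_apply, sum_apply]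
  rfl

theorem shiftedGradL_apply_apply (u : H2 d) (j : Fin d) :
    shiftedGradL η u j = shiftedGrad η u j := by
  rw [shiftedGradL_apply, PiLp.add_apply, WithLp.ofLp_sum, Finset.sum_apply,
    Finset.sum_eq_single j]
  · simp only [singleL, ContinuousLinearMap.comp_apply, ContinuousLinearMap.single_apply,
      ContinuousLinearEquiv.coe_coe, PiLp.continuousLinearEquiv_symm_apply, PiLp.toLp_single,
      PiLp.smul_apply, PiLp.single_eq_same, shiftedGrad]
    rw [mul_comm, mul_smul, Complex.coe_smul]
    rfl
  · intro i _ hi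
    simp [singleL, hi]
  · simp

theorem shiftedLaplacianL_apply (u : H2 d) :
    shiftedLaplacianL η u = u.laplacian +
      ∑ j, η j • ((2 * Complex.I) • u.grad j - η j • u.toL2) := by
  rw [shiftedLaplacianL, add_apply, sum_apply, laplacianL_apply]
  rfl

theorem shiftedLaplacianL_apply_eq (u : H2 d) :
    shiftedLaplacianL η u = shiftedLaplacian η u := by
  rw [shiftedLaplacianL_apply, shiftedLaplacian]
  simp only [smul_sub, Finset.sum_sub_distrib, ← add_sub_assoc]
  congr 2
  · refine Finset.sum_congr rfl fun j _ => ?_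
    rw [mul_comm _ (η j : ℂ), mul_smul (η j : ℂ), Complex.coe_smul]
    rfl
  · rw [Complex.coe_smul, EuclideanSpace.norm_sq_eq]
    refine Eq.trans (Finset.sum_congr rfl fun j _ => ?_) (Finset.sum_smul ..).symm
    rw [Real.norm_eq_abs, sq_abs, sq, mul_smul]

theorem shiftedGradL_zero : shiftedGradL (0 : EuclideanSpace ℝ (Fin d)) = gradL d :=
  ContinuousLinearMap.ext fun u => by simp [shiftedGradL_apply]

theorem shiftedLaplacianL_zero :
    shiftedLaplacianL (0 : EuclideanSpace ℝ (Fin d)) = laplacianL d :=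
  ContinuousLinearMap.ext fun u => by simp [shiftedLaplacianL_apply, laplacianL_apply]

theorem contDiff_shiftedGradL : ContDiff ℝ ω (shiftedGradL (d := d)) :=
  contDiff_const_add_sum_smul _ fun _ => contDiff_const

theorem contDiff_shiftedLaplacianL : ContDiff ℝ ω (shiftedLaplacianL (d := d)) :=
  contDiff_const_add_sum_smul _ fun j => contDiff_const_sub_smul _ _ j

end H2

/-- The bounded operator on `H²_♯(Y)` representing the form `a^ρ[η]`. -/
def blochOp (hA : IsCoefficient A) (ρ : ℝ) (η : EuclideanSpace ℝ (Fin d)) : H2 d →L[ℂ] H2 d :=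
  energyOp (coeffOp hA) (ρ ^ 2) (H2.shiftedGradL η) (H2.shiftedLaplacianL η)

/-- The bounded operator on `H²_♯(Y)` representing the `L²_♯(Y)` inner product. -/
def massOp (d : ℕ) : H2 d →L[ℂ] H2 d := adjoint (H2.toL2L d) ∘L H2.toL2L d

theorem inner_massOp (u v : H2 d) :
    ⟪v, massOp d u⟫_ℂ = ∫ y in cell d, u.toL2 y * conj (v.toL2 y) := by
  rw [massOp, ContinuousLinearMap.comp_apply, ContinuousLinearMap.adjoint_inner_right, inner_L2]
  rfl

theorem inner_blochOp (hA : IsCoefficient A) (ρ : ℝ) (u v : H2 d) :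
    ⟪v, blochOp hA ρ η u⟫_ℂ = blochForm A ρ η u v := by
  rw [blochOp, inner_energyOp, inner_coeffOp, inner_L2, blochForm]
  simp only [H2.shiftedGradL_apply_apply, H2.shiftedLaplacianL_apply_eq]
  norm_cast

theorem solvesBloch_iff (hA : IsCoefficient A) {ρ μ : ℝ} {u : H2 d} :
    SolvesBloch A ρ η μ u ↔ blochOp hA ρ η u = (μ : ℂ) • massOp d u := by
  simp only [SolvesBloch, ← inner_blochOp hA, ← inner_massOp, ← inner_smul_right]
  exact ⟨ext_inner_left ℂ, fun h v => by rw [h]⟩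

theorem blochOp_isSymmetric (hA : IsCoefficient A) (ρ : ℝ) :
    (blochOp hA ρ η : H2 d →ₗ[ℂ] H2 d).IsSymmetric :=
  energyOp_isSymmetric (coeffOp_isSymmetric hA)

theorem massOp_isPositive : (massOp d : H2 d →ₗ[ℂ] H2 d).IsPositive :=
  (ContinuousLinearMap.isPositive_adjoint_comp_self (H2.toL2L d)).toLinearMap

theorem re_inner_massOp (u : H2 d) : (⟪u, massOp d u⟫_ℂ).re = ‖u.toL2‖ ^ 2 := by
  rw [massOp, ContinuousLinearMap.comp_apply, ContinuousLinearMap.adjoint_inner_right]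
  exact (norm_sq_eq_re_inner (𝕜 := ℂ) _).symm

theorem inner_massOp_one (v : H2 d) :
    ⟪massOp d (H2.one d), v⟫_ℂ = (volume.real (cell d) : ℝ) * H2.mean d v := by
  rw [massOp, ContinuousLinearMap.comp_apply, ContinuousLinearMap.adjoint_inner_left,
    H2.toL2L_one, inner_oneL2, H2.mean_apply]

theorem blochOp_zero_one (hA : IsCoefficient A) (ρ : ℝ) : blochOp hA ρ 0 (H2.one d) = 0 := by
  rw [blochOp, energyOp_apply, H2.shiftedGradL_zero, H2.shiftedLaplacianL_zero, H2.gradL_one,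
    H2.laplacianL_one, map_zero, map_zero, map_zero, smul_zero, add_zero]

theorem contDiff_blochOp (hA : IsCoefficient A) (ρ : ℝ) : ContDiff ℝ ω (blochOp hA ρ) :=
  contDiff_iff_contDiffAt.2 fun _ => contDiffAt_energyOp H2.contDiff_shiftedGradL.contDiffAt
    H2.contDiff_shiftedLaplacianL.contDiffAt

theorem re_inner_blochOp_ge (hA : IsCoefficient A) (ρ : ℝ) {α : ℝ}
    (hα : ∀ᵐ y, ∀ ξ : Fin d → ℝ, α * ∑ j, ξ j ^ 2 ≤ ∑ j, ∑ k, A y j k * ξ k * ξ j) (u : H2 d) :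
    α * ‖H2.shiftedGradL η u‖ ^ 2 + ρ ^ 2 * ‖H2.shiftedLaplacianL η u‖ ^ 2 ≤
      (⟪u, blochOp hA ρ η u⟫_ℂ).re :=
  re_inner_energyOp_ge (re_inner_coeffOp_ge hA hα) u

theorem re_inner_massOp_le_blochOp (hA : IsCoefficient A) (ρ : ℝ) {α : ℝ} (hα0 : 0 ≤ α)
    (hα : ∀ᵐ y, ∀ ξ : Fin d → ℝ, α * ∑ j, ξ j ^ 2 ≤ ∑ j, ∑ k, A y j k * ξ k * ξ j)
    (hη : ∀ j, |η j| ≤ 1 / 2) {u : H2 d} (hu : H2.mean d u = 0) :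
    α / 4 * (⟪u, massOp d u⟫_ℂ).re ≤ (⟪u, blochOp hA ρ η u⟫_ℂ).re := by
  have hpoincare := H2.norm_sq_toL2_le hη u
  rw [hu, norm_zero] at hpoincare
  have hgrad : ‖H2.shiftedGradL η u‖ ^ 2 = ∑ j, ‖H2.shiftedGrad η u j‖ ^ 2 := by
    simp only [PiLp.norm_sq_eq_of_L2, H2.shiftedGradL_apply_apply]
  calc α / 4 * (⟪u, massOp d u⟫_ℂ).re ≤ α * ‖H2.shiftedGradL η u‖ ^ 2 := by
        rw [re_inner_massOp, hgrad]
        nlinarith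
    _ ≤ (⟪u, blochOp hA ρ η u⟫_ℂ).re :=
        (le_add_of_nonneg_right (by positivity)).trans (re_inner_blochOp_ge hA ρ hα u)

theorem exists_blochOp_zero_coercive (hA : IsCoefficient A) {ρ : ℝ} (hρ : ρ ≠ 0) :
    ∃ κ : ℝ, 0 < κ ∧ ∀ v : H2 d, H2.mean d v = 0 →
      κ * ‖v‖ ^ 2 ≤ (⟪v, blochOp hA ρ 0 v⟫_ℂ).re := by
  obtain ⟨α, hα0, hα⟩ := hA.elliptic
  have hρ2 : 0 < ρ ^ 2 := by positivity
  refine ⟨min (α / 5) (ρ ^ 2), lt_min (by positivity) hρ2, fun v hv => ?_⟩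
  have hnorm := H2.norm_sq_le v
  have henergy := re_inner_blochOp_ge hA ρ (η := 0) hα v
  rw [H2.shiftedGradL_zero, H2.shiftedLaplacianL_zero] at henergy
  rw [hv, norm_zero] at hnorm
  have hκα : min (α / 5) (ρ ^ 2) ≤ α / 5 := min_le_left _ _
  have hκρ : min (α / 5) (ρ ^ 2) ≤ ρ ^ 2 := min_le_right _ _
  have hκ0 : 0 ≤ min (α / 5) (ρ ^ 2) := by positivity
  calc min (α / 5) (ρ ^ 2) * ‖v‖ ^ 2
      ≤ min (α / 5) (ρ ^ 2) * (5 * ‖H2.gradL d v‖ ^ 2) +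
          min (α / 5) (ρ ^ 2) * ‖H2.laplacianL d v‖ ^ 2 := by nlinarith
    _ ≤ α / 5 * (5 * ‖H2.gradL d v‖ ^ 2) + ρ ^ 2 * ‖H2.laplacianL d v‖ ^ 2 := by gcongr
    _ ≤ (⟪v, blochOp hA ρ 0 v⟫_ℂ).re := by linarith

end BlochOperator

section CellProblem

open ContinuousLinearMap (adjoint)

variable {A : (Fin d → ℝ) → Matrix (Fin d) (Fin d) ℝ} {ρ : ℝ} {l : Fin d} {χ : H2 d}

/-- The element of `H²_♯(Y)` representing `v ↦ ∫_Y A e_l · ∇v`, the weak form of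
`-div (A e_l)`. -/
def cellForce (hA : IsCoefficient A) (l : Fin d) : H2 d :=
  adjoint (H2.gradL d) (coeffOp hA (constField l))

theorem inner_cellForce_one (hA : IsCoefficient A) (l : Fin d) :
    ⟪cellForce hA l, H2.one d⟫_ℂ = 0 := by
  rw [cellForce, ContinuousLinearMap.adjoint_inner_left, H2.gradL_one, inner_zero_right]

theorem inner_gradL_coeffOp (hA : IsCoefficient A) (l : Fin d) (u v : H2 d) :
    ⟪H2.gradL d v, coeffOp hA (constField l + H2.gradL d u)⟫_ℂ =
      ∫ y in cell d, ∑ j, ∑ k,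
        (A y j k : ℂ) * ((if k = l then 1 else 0) + u.grad k y) * conj (v.grad j y) := by
  rw [inner_coeffOp]
  refine integral_congr_ae ?_
  filter_upwards [coeFn_constField_add l (H2.gradL d u)] with y hy
  simp only [hy, H2.gradL_apply]

theorem solvesCellProblem_iff (hA : IsCoefficient A) :
    SolvesCellProblem A ρ l χ ↔ H2.mean d χ = 0 ∧ blochOp hA ρ 0 χ = -cellForce hA l := by
  have hweak : ∀ v : H2 d, ⟪v, blochOp hA ρ 0 χ + cellForce hA l⟫_ℂ =
      (ρ : ℂ) ^ 2 * (∫ y in cell d, χ.laplacian y * conj (v.laplacian y)) +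
        ∫ y in cell d, ∑ j, ∑ k,
          (A y j k : ℂ) * ((if k = l then 1 else 0) + χ.grad k y) * conj (v.grad j y) := by
    intro v
    rw [← inner_gradL_coeffOp hA, inner_add_right, blochOp, inner_energyOp, cellForce,
      ContinuousLinearMap.adjoint_inner_right, H2.shiftedGradL_zero, H2.shiftedLaplacianL_zero,
      H2.laplacianL_apply, H2.laplacianL_apply, inner_L2, map_add, inner_add_right,
      add_right_comm, add_comm, add_comm (inner ..)]
    norm_cast
  rw [SolvesCellProblem, H2.mean_eq_cellMean, ← add_eq_zero_iff_eq_neg]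
  simp only [← hweak]
  refine and_congr_right fun _ => ⟨fun h => ext_inner_left ℂ fun v => ?_, fun h v => ?_⟩
  · rw [h v, inner_zero_right]
  · rw [h, inner_zero_right]

theorem existsUnique_solvesCellProblem (hA : IsCoefficient A) (hρ : ρ ≠ 0) (l : Fin d) :
    ∃! χ : H2 d, SolvesCellProblem A ρ l χ := by
  obtain ⟨κ, hκ, hcoer⟩ := exists_blochOp_zero_coercive hA hρ
  simp only [solvesCellProblem_iff hA]
  exact existsUnique_map_eq_of_coercive_on_ker (blochOp_isSymmetric hA ρ) H2.mean_one
    (blochOp_zero_one hA ρ) hκ hcoer (volume_real_cell_pos d) inner_massOp_one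
    (by rw [inner_neg_left, inner_cellForce_one, neg_zero])

end CellProblem

section Conjugation

variable {A : (Fin d → ℝ) → Matrix (Fin d) (Fin d) ℝ} {ρ : ℝ} {l : Fin d}

theorem cellMean_conj (f : (Fin d → ℝ) → ℂ) :
    cellMean (fun y => conj (f y)) = conj (cellMean f) := by
  rw [cellMean_eq_integral, cellMean_eq_integral, integral_conj, map_mul, map_inv₀,
    Complex.conj_ofReal]

theorem fourierMode_neg (n : Fin d → ℤ) (y : Fin d → ℝ) :
    fourierMode (-n) y = conj (fourierMode n y) := by
  rw [fourierMode, fourierMode, ← Complex.exp_conj]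
  congr 1
  simp

theorem fourierCoeff_star (f : L2 d) (n : Fin d → ℤ) :
    fourierCoeff (star f) n = conj (fourierCoeff f (-n)) := by
  rw [fourierCoeff, fourierCoeff, ← cellMean_conj]
  refine cellMean_congr_ae ?_
  filter_upwards [Lp.coeFn_star f] with y hy
  rw [hy, fourierMode_neg, map_mul, Complex.conj_conj]
  rfl

theorem IsPartialDeriv.star {j : Fin d} {u g : L2 d} (h : IsPartialDeriv j u g) :
    IsPartialDeriv j (star u) (star g) := by
  intro n
  rw [fourierCoeff_star, fourierCoeff_star, h (-n)]
  simp

namespace H2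

/-- Complex conjugation on `H²_♯(Y)`. -/
def conjugate (u : H2 d) : H2 d :=
  ⟨WithLp.toLp 2 fun i => star (u.1 i), fun j => (u.2.1 j).star, fun j k => (u.2.2 j k).star⟩

theorem coeFn_toL2_conjugate (u : H2 d) :
    u.conjugate.toL2 =ᵐ[volume.restrict (cell d)] fun y => conj (u.toL2 y) :=
  Lp.coeFn_star u.toL2

theorem coeFn_grad_conjugate (u : H2 d) :
    ∀ᵐ y ∂volume.restrict (cell d), ∀ j, u.conjugate.grad j y = conj (u.grad j y) :=
  ae_all_iff.2 fun j => Lp.coeFn_star (u.grad j)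

theorem coeFn_laplacian_conjugate (u : H2 d) :
    u.conjugate.laplacian =ᵐ[volume.restrict (cell d)] fun y => conj (u.laplacian y) := by
  have hstar : ∀ᵐ y ∂volume.restrict (cell d), ∀ j,
      u.conjugate.hess j j y = conj (u.hess j j y) :=
    ae_all_iff.2 fun j => Lp.coeFn_star (u.hess j j)
  filter_upwards [hstar, Lp.coeFn_finsetSum Finset.univ fun j => u.conjugate.hess j j,
    Lp.coeFn_finsetSum Finset.univ fun j => u.hess j j] with y hhess hconj hsum
  rw [laplacian, laplacian, hconj, hsum, Finset.sum_apply, Finset.sum_apply, map_sum]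
  exact Finset.sum_congr rfl fun j _ => hhess j

end H2

theorem SolvesCellProblem.conjugate {χ : H2 d} (h : SolvesCellProblem A ρ l χ) :
    SolvesCellProblem A ρ l χ.conjugate := by
  refine ⟨?_, fun v => ?_⟩
  · rw [cellMean_congr_ae χ.coeFn_toL2_conjugate, cellMean_conj, h.1, map_zero]
  · have hconj := congrArg conj (h.2 v.conjugate)
    rw [map_add, map_mul, map_pow, Complex.conj_ofReal, map_zero, ← integral_conj,
      ← integral_conj] at hconj
    refine (congrArg₂ _ (congrArg _ ?_) ?_).trans hconj
    · refine integral_congr_ae ?_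
      filter_upwards [χ.coeFn_laplacian_conjugate, v.coeFn_laplacian_conjugate] with y hχ hv
      rw [hχ, hv, map_mul, Complex.conj_conj]
    · refine integral_congr_ae ?_
      filter_upwards [χ.coeFn_grad_conjugate, v.coeFn_grad_conjugate] with y hχ hv
      simp only [hχ, hv, map_sum, map_mul, map_add, Complex.conj_conj, Complex.conj_ofReal,
        apply_ite conj, map_one, map_zero]

end Conjugation

section HomogenizedMatrix

variable {A : (Fin d → ℝ) → Matrix (Fin d) (Fin d) ℝ} {ρ : ℝ} {χ : Fin d → H2 d}

theorem homogenizedMatrix_conj (hA : IsCoefficient A) (hρ : ρ ≠ 0)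
    (hχ : ∀ l, SolvesCellProblem A ρ l (χ l)) (k l : Fin d) :
    conj (homogenizedMatrix A χ k l) = homogenizedMatrix A χ k l := by
  have hreal : (χ l).conjugate = χ l :=
    (existsUnique_solvesCellProblem hA hρ l).unique (hχ l).conjugate (hχ l)
  rw [homogenizedMatrix, ← cellMean_conj]
  refine cellMean_congr_ae ?_
  filter_upwards [(χ l).coeFn_grad_conjugate] with y hy
  simp only [map_add, map_sum, map_mul, Complex.conj_ofReal, ← hy, hreal]

theorem homogenizedMatrix_eq_energy (hA : IsCoefficient A)
    (hχ : ∀ l, SolvesCellProblem A ρ l (χ l)) (k l : Fin d) :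
    volume.real (cell d) * homogenizedMatrix A χ k l =
      ⟪constField k, coeffOp hA (constField l)⟫_ℂ - ⟪χ k, blochOp hA ρ 0 (χ l)⟫_ℂ := by
  have hcross : ⟪constField k, coeffOp hA (H2.gradL d (χ l))⟫_ℂ = ⟪cellForce hA k, χ l⟫_ℂ := by
    rw [cellForce, ContinuousLinearMap.adjoint_inner_left, (coeffOp_isSymmetric hA).apply_clm]
  rw [homogenizedMatrix_eq_inner hA, map_add, inner_add_right, hcross,
    ← neg_eq_iff_eq_neg.2 ((solvesCellProblem_iff hA).1 (hχ k)).2, inner_neg_left,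
    (blochOp_isSymmetric hA ρ).apply_clm, sub_eq_add_neg]

theorem homogenizedMatrix_conj_swap (hA : IsCoefficient A)
    (hχ : ∀ l, SolvesCellProblem A ρ l (χ l)) (k l : Fin d) :
    conj (homogenizedMatrix A χ k l) = homogenizedMatrix A χ l k := by
  have hV : (volume.real (cell d) : ℂ) ≠ 0 :=
    Complex.ofReal_ne_zero.2 (volume_real_cell_pos d).ne'
  refine mul_left_cancel₀ hV ?_
  rw [homogenizedMatrix_eq_energy hA hχ l k, ← Complex.conj_ofReal, ← map_mul,
    homogenizedMatrix_eq_energy hA hχ k l, map_sub, inner_conj_symm, inner_conj_symm,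
    (coeffOp_isSymmetric hA).apply_clm, (blochOp_isSymmetric hA ρ).apply_clm]

end HomogenizedMatrix

section FirstEigenvalue

variable {A : (Fin d → ℝ) → Matrix (Fin d) (Fin d) ℝ} {ρ μ lam : ℝ}
  {η : EuclideanSpace ℝ (Fin d)} {u φ : H2 d}

theorem re_inner_massOp_pos (hu : u ≠ 0) : 0 < (⟪u, massOp d u⟫_ℂ).re := by
  rw [re_inner_massOp]
  have h : u.toL2 ≠ 0 := (map_ne_zero_iff _ H2.toL2L_injective).2 hu
  positivity

theorem blochEigenvalues_nonneg (hA : IsCoefficient A) (hμ : μ ∈ blochEigenvalues A ρ η) :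
    0 ≤ μ := by
  obtain ⟨u, hu, hsolves⟩ := hμ
  obtain ⟨α, hα0, hα⟩ := hA.elliptic
  have henergy := (by positivity : (0 : ℝ) ≤ _).trans (re_inner_blochOp_ge hA ρ (η := η) hα u)
  rw [inner_blochOp, hsolves u, ← inner_massOp, Complex.re_ofReal_mul] at henergy
  exact nonneg_of_mul_nonneg_left henergy (re_inner_massOp_pos hu)

theorem firstBlochEigenvalue_nonneg (hA : IsCoefficient A) : 0 ≤ firstBlochEigenvalue A ρ η :=
  Real.sInf_nonneg fun _ => blochEigenvalues_nonneg hA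

theorem firstBlochEigenvalue_zero (hA : IsCoefficient A) : firstBlochEigenvalue A ρ 0 = 0 := by
  have hone : H2.one d ≠ 0 := fun h => by simpa [h] using H2.mean_one (d := d)
  have hmem : 0 ∈ blochEigenvalues A ρ 0 := ⟨H2.one d, hone, (solvesBloch_iff hA).2 <| by
    rw [blochOp_zero_one, Complex.ofReal_zero, zero_smul]⟩
  exact IsLeast.csInf_eq ⟨hmem, fun _ => blochEigenvalues_nonneg hA⟩

theorem partialEta_firstBlochEigenvalue (hA : IsCoefficient A) (l : Fin d) :
    partialEta l (firstBlochEigenvalue A ρ) 0 = 0 := by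
  have hmin : IsLocalMin (firstBlochEigenvalue A ρ) 0 := Eventually.of_forall fun η => by
    rw [firstBlochEigenvalue_zero hA]
    exact firstBlochEigenvalue_nonneg hA
  rw [partialEta, hmin.fderiv_eq_zero, zero_apply]

theorem isLeast_blochEigenvalues (hA : IsCoefficient A) {α : ℝ} (hα0 : 0 ≤ α)
    (hα : ∀ᵐ y, ∀ ξ : Fin d → ℝ, α * ∑ j, ξ j ^ 2 ≤ ∑ j, ∑ k, A y j k * ξ k * ξ j)
    (hη : ∀ j, |η j| ≤ 1 / 2) (hφ : SolvesBloch A ρ η lam φ) (hmean : H2.mean d φ ≠ 0)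
    (hlam : lam ≤ α / 4) : IsLeast (blochEigenvalues A ρ η) lam := by
  have hφ0 : φ ≠ 0 := fun h => hmean (by rw [h, map_zero])
  refine ⟨⟨φ, hφ0, hφ⟩, ?_⟩
  rintro μ ⟨u, hu, hsolves⟩
  exact le_of_pencil_eigenvectors (ℓ := (H2.mean d : H2 d →ₗ[ℂ] ℂ)) (blochOp_isSymmetric hA ρ)
    massOp_isPositive (fun v hv => re_inner_massOp_le_blochOp hA ρ hα0 hα hη hv) hlam
    ((solvesBloch_iff hA).1 hφ) hmean ((solvesBloch_iff hA).1 hsolves) (re_inner_massOp_pos hu)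

theorem solvesBloch_re (hA : IsCoefficient A) {z : ℂ} (hφ0 : φ ≠ 0)
    (hφ : blochOp hA ρ η φ = z • massOp d φ) : SolvesBloch A ρ η z.re φ := by
  have hne : ⟪φ, massOp d φ⟫_ℂ ≠ 0 := fun h => by simpa [h] using re_inner_massOp_pos hφ0
  rw [solvesBloch_iff hA, Complex.conj_eq_iff_re.1 (conj_eq_of_pencil_eigenvector
    (blochOp_isSymmetric hA ρ) massOp_isPositive.isSymmetric hφ hne), hφ]

theorem exists_analyticAt_bloch_eigenpair (hA : IsCoefficient A) (hρ : ρ ≠ 0) :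
    ∃ (lam : EuclideanSpace ℝ (Fin d) → ℝ) (φ : EuclideanSpace ℝ (Fin d) → H2 d),
      AnalyticAt ℝ lam 0 ∧ AnalyticAt ℝ φ 0 ∧ lam 0 = 0 ∧
        ∀ᶠ η in 𝓝 0, H2.mean d (φ η) = 1 ∧ SolvesBloch A ρ η (lam η) (φ η) := by
  obtain ⟨κ, hκ, hcoer⟩ := exists_blochOp_zero_coercive hA hρ
  have hunit := isUnit_add_smulRight (blochOp_isSymmetric hA ρ) H2.mean_one
    (blochOp_zero_one hA ρ) hκ hcoer (volume_real_cell_pos d) inner_massOp_one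
  obtain ⟨z, φ, hz, hφ, hz0, -, hpair⟩ := exists_analyticAt_eigenpair
    (contDiff_blochOp hA ρ).contDiffAt H2.mean_one (blochOp_zero_one hA ρ) hunit
  refine ⟨fun η => (z η).re, φ, (Complex.reCLM.analyticAt _).comp hz, hφ, by simp [hz0], ?_⟩
  filter_upwards [hpair] with η ⟨hmean, hsolves⟩
  exact ⟨hmean, solvesBloch_re hA (fun h => by simp [h] at hmean) hsolves⟩

theorem exists_analyticAt_firstBlochEigenpair (hA : IsCoefficient A) (hρ : ρ ≠ 0) :
    AnalyticAt ℝ (firstBlochEigenvalue A ρ) 0 ∧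
      (∀ᶠ η in 𝓝 0, IsLeast (blochEigenvalues A ρ η) (firstBlochEigenvalue A ρ η)) ∧
      ∃ φ : EuclideanSpace ℝ (Fin d) → H2 d, AnalyticAt ℝ φ 0 ∧
        ∀ᶠ η in 𝓝 0, H2.mean d (φ η) = 1 ∧
          SolvesBloch A ρ η (firstBlochEigenvalue A ρ η) (φ η) := by
  obtain ⟨lam, φ, hlam, hφ, hlam0, hpair⟩ := exists_analyticAt_bloch_eigenpair hA hρ
  obtain ⟨α, hα0, hα⟩ := hA.elliptic
  have hsmall : ∀ᶠ η in 𝓝 0, lam η < α / 4 :=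
    hlam.continuousAt.eventually_lt continuousAt_const (by rw [hlam0]; positivity)
  have hbox : ∀ᶠ η : EuclideanSpace ℝ (Fin d) in 𝓝 0, ∀ j, |η j| ≤ 1 / 2 := by
    filter_upwards [Metric.closedBall_mem_nhds (0 : EuclideanSpace ℝ (Fin d)) one_half_pos]
      with η hη j
    exact (PiLp.norm_apply_le η j).trans (mem_closedBall_zero_iff.1 hη)
  have hleast : ∀ᶠ η in 𝓝 0, IsLeast (blochEigenvalues A ρ η) (lam η) := by
    filter_upwards [hpair, hsmall, hbox] with η ⟨hmean, hsolves⟩ hlt hη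
    exact isLeast_blochEigenvalues hA hα0.le hα hη hsolves (by simp [hmean]) hlt.le
  have heq : ∀ᶠ η in 𝓝 0, lam η = firstBlochEigenvalue A ρ η :=
    hleast.mono fun η h => h.csInf_eq.symm
  refine ⟨hlam.congr heq, ?_, φ, hφ, ?_⟩
  · filter_upwards [hleast, heq] with η hη hlam
    rwa [← hlam]
  · filter_upwards [hpair, heq] with η hη hlam
    rwa [← hlam]

theorem exists_isFirstBlochEigenfunction (hA : IsCoefficient A) (hρ : ρ ≠ 0) :
    ∃ δ : ℝ, 0 < δ ∧
      (∀ η ∈ Metric.ball (0 : EuclideanSpace ℝ (Fin d)) δ,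
        IsLeast (blochEigenvalues A ρ η) (firstBlochEigenvalue A ρ η)) ∧
      AnalyticOnNhd ℝ (firstBlochEigenvalue A ρ) (Metric.ball 0 δ) ∧
      ∃ φ : EuclideanSpace ℝ (Fin d) → H2 d, IsFirstBlochEigenfunction A ρ δ φ := by
  obtain ⟨hlam, hleast, φ, hφ, hpair⟩ := exists_analyticAt_firstBlochEigenpair hA hρ
  obtain ⟨δ, hδ, hball⟩ := Metric.eventually_nhds_iff_ball.1
    (hleast.and (hlam.eventually_analyticAt.and (hφ.eventually_analyticAt.and hpair)))
  set c : ℂ := (((2 * Real.pi) ^ (-(d : ℝ) / 2) : ℝ) : ℂ)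
  refine ⟨δ, hδ, fun η hη => (hball η hη).1, fun η hη => (hball η hη).2.1, fun η => c • φ η,
    fun η hη => (hball η hη).2.2.1.fun_const_smul, fun η hη => ?_, fun η hη => ?_⟩
  · rw [solvesBloch_iff hA, map_smul, map_smul, smul_comm,
      (solvesBloch_iff hA).1 (hball η hη).2.2.2.2]
  · rw [← H2.mean_eq_cellMean, map_smul, (hball η hη).2.2.2.1, smul_eq_mul, mul_one]

end FirstEigenvalue

section Perturbation

variable {A : (Fin d → ℝ) → Matrix (Fin d) (Fin d) ℝ} {ρ : ℝ} {l : Fin d} {c : ℂ}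
  {η : EuclideanSpace ℝ (Fin d)} {φ : EuclideanSpace ℝ (Fin d) → H2 d}

theorem eq_smul_one_of_solvesBloch_zero (hA : IsCoefficient A) (hρ : ρ ≠ 0) {u : H2 d}
    (hu : SolvesBloch A ρ 0 0 u) : u = H2.mean d u • H2.one d := by
  obtain ⟨κ, hκ, hcoer⟩ := exists_blochOp_zero_coercive hA hρ
  refine eq_smul_of_coercive_on_ker H2.mean_one (blochOp_zero_one hA ρ) hκ hcoer ?_
  rw [(solvesBloch_iff hA).1 hu, Complex.ofReal_zero, zero_smul]

namespace H2

theorem contDiffAt_shiftedGradL_apply {n : WithTop ℕ∞} (hφ : ContDiffAt ℝ n φ η) :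
    ContDiffAt ℝ n (fun x => shiftedGradL x (φ x)) η :=
  contDiffAt_clm_apply (contDiff_shiftedGradL.contDiffAt.of_le le_top) hφ

theorem contDiffAt_shiftedLaplacianL_apply {n : WithTop ℕ∞} (hφ : ContDiffAt ℝ n φ η) :
    ContDiffAt ℝ n (fun x => shiftedLaplacianL x (φ x)) η :=
  contDiffAt_clm_apply (contDiff_shiftedLaplacianL.contDiffAt.of_le le_top) hφ

theorem partialEta_shiftedGradL_zero (l : Fin d) :
    partialEta l shiftedGradL 0 = Complex.I • singleL l ∘L toL2L d :=
  partialEta_const_add_sum_smul_zero (gradL d) (fun _ => differentiableAt_const _) l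

theorem partialEta_shiftedLaplacianL_zero (l : Fin d) :
    partialEta l shiftedLaplacianL 0 = (2 * Complex.I) • jetL (d := d) (.inr (.inl l)) :=
  (partialEta_const_add_sum_smul_zero (laplacianL d)
    (fun j => (contDiff_const_sub_smul (n := 1) _ _ j).differentiable one_ne_zero 0) l).trans
    (by simp)

theorem partialEta_shiftedGradL_apply (hφ : DifferentiableAt ℝ φ 0) (hφ0 : φ 0 = c • one d)
    (l : Fin d) : partialEta l (fun η => shiftedGradL η (φ η)) 0 =
      gradL d (partialEta l φ 0) + (Complex.I * c) • constField l := by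
  rw [partialEta_clm_apply (contDiff_shiftedGradL.differentiable (by simp) 0) hφ,
    partialEta_shiftedGradL_zero, shiftedGradL_zero, hφ0, map_smul, mul_comm, mul_smul]
  rfl

theorem partialEta_shiftedLaplacianL_apply (hφ : DifferentiableAt ℝ φ 0)
    (hφ0 : φ 0 = c • one d) (l : Fin d) :
    partialEta l (fun η => shiftedLaplacianL η (φ η)) 0 = laplacianL d (partialEta l φ 0) := by
  have hgrad : jetL (.inr (.inl l)) (one d) = 0 := rfl
  rw [partialEta_clm_apply (contDiff_shiftedLaplacianL.differentiable (by simp) 0) hφ,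
    partialEta_shiftedLaplacianL_zero, shiftedLaplacianL_zero, hφ0, map_smul, smul_apply, hgrad,
    smul_zero, smul_zero, add_zero]

end H2

theorem partialEta_blochOp_apply (hA : IsCoefficient A) (ρ : ℝ) (hφ : ContDiffAt ℝ 1 φ 0)
    (hφ0 : φ 0 = c • H2.one d) (l : Fin d) :
    partialEta l (fun η => blochOp hA ρ η (φ η)) 0 =
      blochOp hA ρ 0 (partialEta l φ 0) + (Complex.I * c) • cellForce hA l := by
  have hgrad : H2.shiftedGradL 0 (φ 0) = 0 := by
    rw [hφ0, map_smul, H2.shiftedGradL_zero, H2.gradL_one, smul_zero]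
  have hlaplacian : H2.shiftedLaplacianL 0 (φ 0) = 0 := by
    rw [hφ0, map_smul, H2.shiftedLaplacianL_zero, H2.laplacianL_one, smul_zero]
  have hdiff := hφ.differentiableAt one_ne_zero
  refine (partialEta_energyOp_apply (H2.contDiff_shiftedGradL.contDiffAt.of_le le_top)
    (H2.contDiff_shiftedLaplacianL.contDiffAt.of_le le_top) hφ hgrad hlaplacian l).trans ?_
  rw [H2.partialEta_shiftedGradL_apply hdiff hφ0, H2.partialEta_shiftedLaplacianL_apply hdiff hφ0,
    blochOp, energyOp_apply, H2.shiftedGradL_zero, H2.shiftedLaplacianL_zero, map_add, map_add,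
    map_smul, map_smul, add_right_comm]
  rfl

theorem firstBlochEigenfunction_zero (hA : IsCoefficient A) (hρ : ρ ≠ 0)
    (hmean : ∀ᶠ η in 𝓝 0, H2.mean d (φ η) = c)
    (hsolves : ∀ᶠ η in 𝓝 0, SolvesBloch A ρ η (firstBlochEigenvalue A ρ η) (φ η)) :
    φ 0 = c • H2.one d := by
  have hzero := hsolves.self_of_nhds
  rw [firstBlochEigenvalue_zero hA] at hzero
  rw [← hmean.self_of_nhds]
  exact eq_smul_one_of_solvesBloch_zero hA hρ hzero

theorem mean_partialEta_eq_zero (hφ : DifferentiableAt ℝ φ 0)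
    (hmean : ∀ᶠ η in 𝓝 0, H2.mean d (φ η) = c) (l : Fin d) :
    H2.mean d (partialEta l φ 0) = 0 := by
  refine (partialEta_clm_comp ((H2.mean d).restrictScalars ℝ) hφ l).symm.trans ?_
  refine (partialEta_congr (g := fun _ => c) hmean l).trans ?_
  rw [partialEta, fderiv_fun_const]
  rfl

theorem partialEta_firstBlochEigenvalue_smul_massOp (hA : IsCoefficient A) (hρ : ρ ≠ 0)
    (hφ : DifferentiableAt ℝ φ 0) (l : Fin d) :
    partialEta l (fun η => (firstBlochEigenvalue A ρ η : ℂ) • massOp d (φ η)) 0 = 0 := by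
  have hlam := (exists_analyticAt_firstBlochEigenpair hA hρ).1.differentiableAt
  have hmass := ((massOp d).restrictScalars ℝ).differentiableAt.comp 0 hφ
  simp only [Complex.coe_smul]
  refine (partialEta_smul hlam hmass l).trans ?_
  rw [firstBlochEigenvalue_zero hA, partialEta_firstBlochEigenvalue hA, zero_smul, zero_smul,
    add_zero]

theorem partialEta_firstBlochEigenfunction (hA : IsCoefficient A) (hρ : ρ ≠ 0)
    (hφ : ContDiffAt ℝ 1 φ 0) (hmean : ∀ᶠ η in 𝓝 0, H2.mean d (φ η) = c)
    (hsolves : ∀ᶠ η in 𝓝 0, SolvesBloch A ρ η (firstBlochEigenvalue A ρ η) (φ η))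
    {χ : H2 d} (hχ : SolvesCellProblem A ρ l χ) : partialEta l φ 0 = (Complex.I * c) • χ := by
  have hdiff := hφ.differentiableAt one_ne_zero
  have hφ0 := firstBlochEigenfunction_zero hA hρ hmean hsolves
  have hderiv : blochOp hA ρ 0 (partialEta l φ 0) + (Complex.I * c) • cellForce hA l = 0 := by
    rw [← partialEta_blochOp_apply hA ρ hφ hφ0,
      partialEta_congr (hsolves.mono fun _ => (solvesBloch_iff hA).1)]
    exact partialEta_firstBlochEigenvalue_smul_massOp hA hρ hdiff l
  obtain ⟨hχmean, hχop⟩ := (solvesCellProblem_iff hA).1 hχ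
  obtain ⟨κ, hκ, hcoer⟩ := exists_blochOp_zero_coercive hA hρ
  refine sub_eq_zero.1 (eq_zero_of_coercive_on_ker hκ hcoer ?_ ?_)
  · rw [map_sub, map_smul, hχmean, mean_partialEta_eq_zero hdiff hmean, smul_zero, sub_zero]
  · rw [map_sub, map_smul, hχop, smul_neg, sub_neg_eq_add, hderiv]

theorem IsFirstBlochEigenfunction.partialEta_sub_const {δ : ℝ}
    (h : IsFirstBlochEigenfunction A ρ δ φ) (hA : IsCoefficient A) (hρ : ρ ≠ 0) (hδ : 0 < δ)
    {χ : H2 d} (hχ : SolvesCellProblem A ρ l χ) :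
    ∃ b : ℂ, ∀ᵐ y ∂volume.restrict (cell d),
      (partialEta l φ 0).toL2 y - Complex.I * (φ 0).toL2 y * χ.toL2 y = b := by
  have hball := Metric.ball_mem_nhds (0 : EuclideanSpace ℝ (Fin d)) hδ
  have hmean := eventually_of_mem hball fun η hη =>
    (H2.mean_eq_cellMean (φ η)).trans (h.normalized η hη)
  have hsolves := eventually_of_mem hball h.solves
  have hφ := (h.analytic 0 (Metric.mem_ball_self hδ)).contDiffAt (n := 1)
  rw [partialEta_firstBlochEigenfunction hA hρ hφ hmean hsolves hχ,
    firstBlochEigenfunction_zero hA hρ hmean hsolves]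
  set c : ℂ := (((2 * Real.pi) ^ (-(d : ℝ) / 2) : ℝ) : ℂ)
  refine ⟨0, ?_⟩
  filter_upwards [Lp.coeFn_smul (Complex.I * c) χ.toL2, Lp.coeFn_smul c (oneL2 d),
    coeFn_oneL2 d] with y hχy hφy hone
  refine (congrArg₂ _ hχy (congrArg (Complex.I * · * χ.toL2 y) hφy)).trans ?_
  simp only [Pi.smul_apply, hone, smul_eq_mul, mul_one, sub_self]

end Perturbation

section Hessian

variable {A : (Fin d → ℝ) → Matrix (Fin d) (Fin d) ℝ} {ρ : ℝ} {η : EuclideanSpace ℝ (Fin d)}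
  {φ : EuclideanSpace ℝ (Fin d) → H2 d}

/-- The coefficient of `η_k` in `a^ρ[η](u, 1)`: the mean flux of `u` in the direction `e_k`, up to
normalization. Since `(∇ + iη)1 = iη` and `(∇ + iη)²1 = -|η|²`, it involves only `(∇ + iη)u` and
`(∇ + iη)²u`. -/
def blochFlux (hA : IsCoefficient A) (ρ : ℝ) (k : Fin d) (η : EuclideanSpace ℝ (Fin d))
    (u : H2 d) : ℂ :=
  -Complex.I * ⟪constField k, coeffOp hA (H2.shiftedGradL η u)⟫_ℂ +
    η k • (-(ρ : ℂ) ^ 2 * ⟪oneL2 d, H2.shiftedLaplacianL η u⟫_ℂ)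

theorem inner_one_blochOp (hA : IsCoefficient A) (ρ : ℝ) (u : H2 d) :
    ⟪H2.one d, blochOp hA ρ η u⟫_ℂ = ∑ k, η k • blochFlux hA ρ k η u := by
  have hgrad : H2.shiftedGradL η (H2.one d) = ∑ k, (η k * Complex.I) • constField k := by
    rw [H2.shiftedGradL_apply, H2.gradL_one, zero_add]
    refine Finset.sum_congr rfl fun k _ => ?_
    rw [H2.toL2L_one, singleL_oneL2, mul_smul, Complex.coe_smul]
    rfl
  have hlaplacian : H2.shiftedLaplacianL η (H2.one d) = ∑ k, (-(η k : ℂ) ^ 2) • oneL2 d := by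
    rw [H2.shiftedLaplacianL_apply, ← H2.laplacianL_apply, H2.laplacianL_one, zero_add]
    refine Finset.sum_congr rfl fun k _ => ?_
    have hgrad : (H2.one d).grad k = 0 := rfl
    rw [hgrad, smul_zero, zero_sub, smul_neg, neg_smul, sq, mul_smul, Complex.coe_smul,
      Complex.coe_smul]
    rfl
  rw [blochOp, inner_energyOp, hgrad, hlaplacian, sum_inner, sum_inner, Finset.mul_sum,
    ← Finset.sum_add_distrib]
  refine Finset.sum_congr rfl fun k _ => ?_
  rw [inner_smul_left, inner_smul_left, blochFlux]
  simp only [map_mul, map_neg, map_pow, Complex.conj_ofReal, Complex.conj_I, Complex.real_smul,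
    RCLike.ofReal_eq_complex_ofReal]
  ring

theorem firstBlochEigenvalue_eq_sum_blochFlux (hA : IsCoefficient A) {lam : ℝ} {u : H2 d}
    (hmean : H2.mean d u = 1) (hu : SolvesBloch A ρ η lam u) :
    lam = ∑ k, η k • ((volume.real (cell d))⁻¹ • Complex.reCLM) (blochFlux hA ρ k η u) := by
  have hV := (volume_real_cell_pos d).ne'
  have hpair : ((volume.real (cell d) * lam : ℝ) : ℂ) = ∑ k, η k • blochFlux hA ρ k η u := by
    rw [← inner_one_blochOp, inner_blochOp, hu, ← inner_massOp,
      ← massOp_isPositive.isSymmetric.apply_clm, inner_massOp_one, hmean, mul_one, mul_comm,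
      Complex.ofReal_mul]
  simp only [← map_smul, ← map_sum]
  rw [← hpair, smul_apply, Complex.reCLM_apply, Complex.ofReal_re, smul_eq_mul,
    inv_mul_cancel_left₀ hV]

theorem contDiffAt_blochFlux (hA : IsCoefficient A) (ρ : ℝ) (k : Fin d) {n : WithTop ℕ∞}
    (hφ : ContDiffAt ℝ n φ η) : ContDiffAt ℝ n (fun x => blochFlux hA ρ k x (φ x)) η := by
  let S₁ := (innerSL ℂ (constField k) ∘L coeffOp hA).restrictScalars ℝ
  let S₂ := (innerSL ℂ (oneL2 d)).restrictScalars ℝ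
  have hgrad := S₁.contDiff.contDiffAt.comp η (H2.contDiffAt_shiftedGradL_apply hφ)
  have hlaplacian := S₂.contDiff.contDiffAt.comp η (H2.contDiffAt_shiftedLaplacianL_apply hφ)
  exact (contDiffAt_const.mul hgrad).add
    ((EuclideanSpace.proj (𝕜 := ℝ) k).contDiff.contDiffAt.smul (contDiffAt_const.mul hlaplacian))

theorem partialEta_blochFlux_zero (hA : IsCoefficient A) (ρ : ℝ) (k l : Fin d) {c : ℂ}
    (hφ : ContDiffAt ℝ 1 φ 0) (hφ0 : φ 0 = c • H2.one d) :
    partialEta l (fun η => blochFlux hA ρ k η (φ η)) 0 =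
      -Complex.I * ⟪constField k, coeffOp hA (H2.gradL d (partialEta l φ 0) +
        (Complex.I * c) • constField l)⟫_ℂ := by
  let S₁ : L2Field d →L[ℝ] ℂ :=
    ((-Complex.I) • innerSL ℂ (constField k) ∘L coeffOp hA).restrictScalars ℝ
  let S₂ : L2 d →L[ℝ] ℂ := ((-(ρ : ℂ) ^ 2) • innerSL ℂ (oneL2 d)).restrictScalars ℝ
  have hgrad := (H2.contDiffAt_shiftedGradL_apply hφ).differentiableAt one_ne_zero
  have hlaplacian := (H2.contDiffAt_shiftedLaplacianL_apply hφ).differentiableAt one_ne_zero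
  have hzero : H2.shiftedLaplacianL 0 (φ 0) = 0 := by
    rw [hφ0, map_smul, H2.shiftedLaplacianL_zero, H2.laplacianL_one, smul_zero]
  have hcoord : DifferentiableAt ℝ (fun η : EuclideanSpace ℝ (Fin d) => η k) 0 :=
    (EuclideanSpace.proj (𝕜 := ℝ) k).differentiableAt
  have hS₂ := S₂.differentiableAt.comp 0 hlaplacian
  calc partialEta l (fun η => blochFlux hA ρ k η (φ η)) 0
      = partialEta l (fun η => S₁ (H2.shiftedGradL η (φ η))) 0 +
          partialEta l (fun η => η k • S₂ (H2.shiftedLaplacianL η (φ η))) 0 :=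
        partialEta_add (S₁.differentiableAt.comp 0 hgrad) (hcoord.smul hS₂) l
    _ = S₁ (partialEta l (fun η => H2.shiftedGradL η (φ η)) 0) := by
        rw [partialEta_clm_comp S₁ hgrad, add_eq_left]
        refine (partialEta_smul hcoord hS₂ l).trans ?_
        rw [Function.comp_apply, hzero, map_zero, smul_zero, add_zero]
        exact zero_smul ..
    _ = _ := by
        rw [H2.partialEta_shiftedGradL_apply (hφ.differentiableAt one_ne_zero) hφ0]
        rfl

theorem partialEta_blochFlux_firstBlochEigenfunction (hA : IsCoefficient A) (hρ : ρ ≠ 0)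
    (hφ : ContDiffAt ℝ 1 φ 0) (hmean : ∀ᶠ η in 𝓝 0, H2.mean d (φ η) = 1)
    (hsolves : ∀ᶠ η in 𝓝 0, SolvesBloch A ρ η (firstBlochEigenvalue A ρ η) (φ η))
    {χ : Fin d → H2 d} (hχ : ∀ l, SolvesCellProblem A ρ l (χ l)) (k l : Fin d) :
    partialEta l (fun η => blochFlux hA ρ k η (φ η)) 0 =
      volume.real (cell d) * homogenizedMatrix A χ k l := by
  rw [partialEta_blochFlux_zero hA ρ k l hφ (firstBlochEigenfunction_zero hA hρ hmean hsolves),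
    partialEta_firstBlochEigenfunction hA hρ hφ hmean hsolves (hχ l),
    homogenizedMatrix_eq_inner hA, map_smul, ← smul_add, map_smul, inner_smul_right, mul_one,
    ← mul_assoc, neg_mul, Complex.I_mul_I, neg_neg, one_mul, add_comm]

theorem half_partialEta_partialEta_firstBlochEigenvalue (hA : IsCoefficient A) (hρ : ρ ≠ 0)
    {χ : Fin d → H2 d} (hχ : ∀ l, SolvesCellProblem A ρ l (χ l)) (k l : Fin d) :
    (((1 / 2 : ℝ) * partialEta k (partialEta l (firstBlochEigenvalue A ρ)) 0 : ℝ) : ℂ) =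
      homogenizedMatrix A χ k l := by
  obtain ⟨-, -, φ, hφ, hpair⟩ := exists_analyticAt_firstBlochEigenpair hA hρ
  set S : ℂ →L[ℝ] ℝ := (volume.real (cell d))⁻¹ • Complex.reCLM
  have hflux : ∀ j, ContDiffAt ℝ 2 (fun η => blochFlux hA ρ j η (φ η)) 0 := fun j =>
    contDiffAt_blochFlux hA ρ j hφ.contDiffAt
  have hSflux : ∀ j, ContDiffAt ℝ 2 (fun η => S (blochFlux hA ρ j η (φ η))) 0 := fun j =>
    S.contDiff.contDiffAt.comp 0 (hflux j)
  have hexpand : firstBlochEigenvalue A ρ =ᶠ[𝓝 0]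
      fun η => ∑ j, η j • S (blochFlux hA ρ j η (φ η)) := by
    filter_upwards [hpair] with η ⟨hmean, hsolves⟩
    exact firstBlochEigenvalue_eq_sum_blochFlux hA hmean hsolves
  have hderiv : ∀ i j, partialEta j (fun η => S (blochFlux hA ρ i η (φ η))) 0 =
      (homogenizedMatrix A χ i j).re := fun i j => by
    rw [partialEta_clm_comp S ((hflux i).differentiableAt two_ne_zero),
      partialEta_blochFlux_firstBlochEigenfunction hA hρ hφ.contDiffAt (hpair.mono fun _ h => h.1)
        (hpair.mono fun _ h => h.2) hχ, smul_apply, Complex.reCLM_apply, Complex.re_ofReal_mul,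
      smul_eq_mul, inv_mul_cancel_left₀ (volume_real_cell_pos d).ne']
  have hsymm : homogenizedMatrix A χ l k = homogenizedMatrix A χ k l :=
    (homogenizedMatrix_conj_swap hA hχ k l).symm.trans (homogenizedMatrix_conj hA hρ hχ k l)
  rw [partialEta_congr (hexpand.eventuallyEq_nhds.mono fun _ h => partialEta_congr h l),
    partialEta_partialEta_sum_smul_zero hSflux, hderiv,
    hderiv, hsymm, ← two_mul, one_div, inv_mul_cancel_left₀ two_ne_zero]
  exact Complex.conj_eq_iff_re.1 (homogenizedMatrix_conj hA hρ hχ k l)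

end Hessian

end BlochWave

end

theorem theorem5p1 {d : ℕ} (A : (Fin d → ℝ) → Matrix (Fin d) (Fin d) ℝ)
    (hA : IsCoefficient A) (ρ : ℝ) (hρ : 0 < ρ) :
    -- the first Bloch eigenvalue and eigenfunction are well defined and analytic near `0`
    (∃ δ : ℝ, 0 < δ ∧
      (∀ η ∈ Metric.ball (0 : EuclideanSpace ℝ (Fin d)) δ,
        IsLeast (blochEigenvalues A ρ η) (firstBlochEigenvalue A ρ η)) ∧
      AnalyticOnNhd ℝ (firstBlochEigenvalue A ρ) (Metric.ball 0 δ) ∧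
      ∃ φ : EuclideanSpace ℝ (Fin d) → H2 d, IsFirstBlochEigenfunction A ρ δ φ) ∧
    firstBlochEigenvalue A ρ 0 = 0 ∧
    (∀ l : Fin d, partialEta l (firstBlochEigenvalue A ρ) 0 = 0) ∧
    -- the correctors exist and are unique
    (∀ l : Fin d, ∃! χ : H2 d, SolvesCellProblem A ρ l χ) ∧
    ∀ χ : Fin d → H2 d, (∀ l, SolvesCellProblem A ρ l (χ l)) →
      (∀ δ : ℝ, 0 < δ → ∀ φ : EuclideanSpace ℝ (Fin d) → H2 d,
        IsFirstBlochEigenfunction A ρ δ φ →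
        ∀ l : Fin d, ∃ c : ℂ, ∀ᵐ y ∂(volume.restrict (cell d)),
          (partialEta l φ 0).toL2 y - Complex.I * (φ 0).toL2 y * (χ l).toL2 y = c) ∧
      ∀ k l : Fin d,
        (((1 / 2 : ℝ) * partialEta k (partialEta l (firstBlochEigenvalue A ρ)) 0 : ℝ) : ℂ) =
          homogenizedMatrix A χ k l :=
  ⟨exists_isFirstBlochEigenfunction hA hρ.ne', firstBlochEigenvalue_zero hA,
    partialEta_firstBlochEigenvalue hA, existsUnique_solvesCellProblem hA hρ.ne', fun _ hχ =>
      ⟨fun _ hδ _ hφ l => hφ.partialEta_sub_const hA hρ.ne' hδ (hχ l),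
        half_partialEta_partialEta_firstBlochEigenvalue hA hρ.ne' hχ⟩⟩
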